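/- Let $K$ be a field. Let $\mathcal H_{CK}$ be the Connes–Kreimer Hopf algebra over $K$: the symmetric algebra on the space spanned by (non-planar, non-empty) rooted trees up to isomorphism, graded by the number of vertices, with the multiplicative coproduct given on trees by $$\Delta_{CK}(t)=\mathbf 1\otimes t+t\otimes\mathbf 1+\sum_{c} P^c(t)\otimes R^c(t),$$ where $c$ runs over the admissible cuts of $t$ (non-empty sets of edges such that the path from the root to any vertex meets at most one of them), $R^c(t)$ is the part containing the root and $P^c(t)$ is the forest of the other parts. Let $\mathcal H$ be the symmetric algebra on the space spanned by the rooted trees with at least one edge, graded by the number of edges, its unit being identified with the one-vertex tree. Let $\Phi:\mathcal H_{CK}\to\mathcal H\otimes\mathcal H_{CK}$ be the algebra morphism given on trees by $\Phi(t)=\sum_s s\otimes t/s$, where $s$ runs over the subforests of $t$ (finite, possibly empty, sets of pairwise disjoint subtrees with at least one edge each; the empty one is the unit of $\mathcal H$) and $t/s$ is obtained by contracting each component of $s$ to a point. Let $\mathcal H^0=\bigoplus_n(\mathcal H_n)^*$ and $\mathcal H_{CK}^0=\bigoplus_n(\mathcal H_{CK,n})^*$ be the graded duals. For $\alpha\in\mathcal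 H^0$ and $a,b\in\mathcal H_{CK}^0$ put $$\langle a*b,x\rangle=\langle a\otimes b,\Delta_{CK}(x)\rangle,\qquad \langle\alpha\star a,x\rangle=\langle\alpha\otimes a,\Phi(x)\rangle\qquad(x\in\mathcal H_{CK}),$$ and let $\Delta(\alpha)=\sum_{(\alpha)}\alpha_1\otimes\alpha_2\in\mathcal H^0\otimes\mathcal H^0$ be the coproduct dual to the product of $\mathcal H$, i.e. $\sum_{(\alpha)}\alpha_1(x)\alpha_2(y)=\alpha(xy)$ for all $x,y\in\mathcal H$. Then for all $\alpha\in\mathcal H^0$ and $a,b\in\mathcal H_{CK}^0$, the forms $\alpha\star a$ and $a*b$ belong to $\mathcal H_{CK}^0$, and $$\sum_{(\alpha)}(\alpha_1\star a)*(\alpha_2\star b)=\alpha\star(a*b).$$ In particular, if $\alpha\in\mathcal H^0$ is an infinitesimal character, i.e. $\alpha(xy)=\alpha(x)\varepsilon(y)+\varepsilon(x)\alpha(y)$ for all $x,y\in\mathcal H$ with $\varepsilon$ the counit of $\mathcal H$ (the constant coefficient), then $\alpha\star(-)$ is a derivation of $*$: $$\alpha\star(a*b)=(\alpha\star a)*b+a*(\alpha\star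 b).$$ -/

import Mathlib

open scoped TensorProduct

noncomputable section

namespace TreeHopf

/-! ### Rooted trees -/

/-- A finite (non-planar) rooted tree, given by its vertices and the order `u ≤ v` meaning that
`u` lies on the path from the root to `v`.  Vertices `≠ root` correspond to edges: such a `v`
stands for the edge that joins `v` to its parent. -/
structure FinTree where
  V : Type
  [fintype : Fintype V]
  [order : PartialOrder V]
  root : V
  root_le : ∀ v : V, root ≤ v
  chain : ∀ u v w : V, u ≤ w → v ≤ w → u ≤ v ∨ v ≤ u

namespace FinTree

attribute [instance] FinTree.fintype FinTree.order

/-- Isomorphism of rooted trees. -/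
instance setoid : Setoid FinTree where
  r s t := Nonempty (s.V ≃o t.V)
  iseqv :=
    { refl := fun t => ⟨OrderIso.refl t.V⟩
      symm := fun ⟨e⟩ => ⟨e.symm⟩
      trans := fun ⟨e⟩ ⟨f⟩ => ⟨e.trans f⟩ }

variable (t : FinTree)

open scoped Classical in
/-- The rooted tree carried by a set of vertices `B` with the induced order, where `r ∈ B` is the
vertex of `B` below all the others. -/
def restrict (B : Set t.V) (r : t.V) (h : IsLeast B r) : FinTree where
  V := B
  root := ⟨r, h.1⟩
  root_le v := h.2 v.2
  chain u v w huw hvw := t.chain u v w huw hvw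

/-! #### Admissible cuts -/

/-- An admissible cut: a non-empty set of edges (an edge is named by its upper vertex, see
`FinTree`) such that the path from the root to any vertex meets at most one of them. -/
def IsAdmissibleCut (C : Finset t.V) : Prop :=
  C.Nonempty ∧ t.root ∉ C ∧ ∀ v, ∀ c ∈ C, ∀ c' ∈ C, c ≤ v → c' ≤ v → c = c'

/-- The type of admissible cuts of `t`. -/
def AdmissibleCut : Type := {C : Finset t.V // t.IsAdmissibleCut C}

open scoped Classical in
instance : Fintype t.AdmissibleCut :=
  inferInstanceAs (Fintype {C : Finset t.V // t.IsAdmissibleCut C})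

/-- The branch of `t` above the edge `c`: all vertices whose path to the root goes through `c`. -/
def branch (c : t.V) : FinTree :=
  t.restrict (Set.Ici c) c ⟨le_refl c, fun _ h => h⟩

/-- The trunk of a cut: the part of `t` that still contains the root after the cut. -/
def trunk (C : t.AdmissibleCut) : FinTree :=
  t.restrict {v | ∀ c ∈ C.1, ¬ c ≤ v} t.root
    ⟨fun c hc h => C.2.2.1 (le_antisymm h (t.root_le c) ▸ hc), fun v _ => t.root_le v⟩

/-! #### Subforests and contraction -/

/-- `B` is the vertex set of a subtree of `t` with at least one edge and with root `r`:
`B` is connected, that is, with `w` it contains the whole path from `r` to `w`. -/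
def IsSubtree (B : Finset t.V) (r : t.V) : Prop :=
  2 ≤ B.card ∧ IsLeast (B : Set t.V) r ∧ ∀ w ∈ B, ∀ x, r ≤ x → x ≤ w → x ∈ B

/-- A subforest of `t`: a set of pairwise disjoint subtrees of `t` with at least one edge each
(given by their vertex sets). The empty set is the trivial subforest. -/
def IsSubforest (s : Finset (Finset t.V)) : Prop :=
  (∀ B ∈ s, ∃ r, t.IsSubtree B r) ∧ (s : Set (Finset t.V)).PairwiseDisjoint id

/-- The type of subforests of `t`. -/
def Subforest : Type := {s : Finset (Finset t.V) // t.IsSubforest s}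

open scoped Classical in
instance : Fintype t.Subforest :=
  inferInstanceAs (Fintype {s : Finset (Finset t.V) // t.IsSubforest s})

variable {t} in
/-- The component of the subforest `s` with vertex set `B`, as a rooted tree. -/
def Subforest.component (s : t.Subforest) (B : {B // B ∈ s.1}) : FinTree :=
  t.restrict (B.1 : Set t.V) (s.2.1 B.1 B.2).choose (s.2.1 B.1 B.2).choose_spec.2.1

variable {t} in
/-- The contracted tree `t / s`: each component of `s` is shrunk to one point, which is represented
by the root of that component, so the other vertices of the components disappear. -/
def Subforest.contract (s : t.Subforest) : FinTree :=
  t.restrict {v | ∀ B ∈ s.1, v ∈ B → IsLeast (B : Set t.V) v} t.root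
    ⟨fun _ _ hv => ⟨hv, fun w _ => t.root_le w⟩, fun v _ => t.root_le v⟩

end FinTree

/-- Rooted trees up to isomorphism. -/
def RTree : Type 1 := Quotient FinTree.setoid

/-- The isomorphism class of a rooted tree. -/
def FinTree.cls (t : FinTree) : RTree := Quotient.mk _ t

/-- A representative of an isomorphism class of rooted trees. It is used below only to form sums
over cuts or subforests that are invariant under isomorphism. -/
def RTree.rep (t : RTree) : FinTree := Quotient.out t

/-- The number of vertices. -/
def RTree.vertices (t : RTree) : ℕ :=
  Quotient.lift (fun s : FinTree => Fintype.card s.V)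
    (by rintro _ _ ⟨e⟩; exact Fintype.card_congr e.toEquiv) t

/-- The number of edges. -/
def RTree.edges (t : RTree) : ℕ := t.vertices - 1

/-- Rooted trees with at least one edge, up to isomorphism. -/
def RTree' : Type 1 := {t : RTree // 1 ≤ t.edges}

/-- The class in `RTree'` of a component of a subforest. -/
def FinTree.Subforest.componentCls {t : FinTree} (s : t.Subforest) (B : {B // B ∈ s.1}) : RTree' :=
  ⟨(s.component B).cls, by
    have h := (s.2.1 B.1 B.2).choose_spec.1
    have e : (s.component B).cls.vertices = B.1.card := by
      change Fintype.card (s.component B).V = _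
      rw [← Fintype.card_coe]
      exact Fintype.card_congr (Equiv.refl _)
    unfold RTree.edges
    omega⟩

/-! ### The algebras and their structure maps -/

variable (K : Type*) [Field K]

/-- The Connes–Kreimer algebra: the symmetric algebra on the space spanned by rooted trees, that is,
polynomials in the rooted trees. Monomials are forests. -/
abbrev HCK := MvPolynomial RTree K

/-- The symmetric algebra on the space spanned by the rooted trees with at least one edge. The
one-vertex tree is identified with its unit. -/
abbrev H := MvPolynomial RTree' K

/-- The coproduct `Δ_CK(t) = 1 ⊗ t + t ⊗ 1 + ∑_c P^c(t) ⊗ R^c(t)` of a rooted tree. -/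
def treeCoproduct (t : RTree) : HCK K ⊗[K] HCK K :=
  1 ⊗ₜ MvPolynomial.X t + MvPolynomial.X t ⊗ₜ 1 +
    ∑ C : t.rep.AdmissibleCut,
      (∏ c ∈ C.1, MvPolynomial.X (t.rep.branch c).cls) ⊗ₜ MvPolynomial.X (t.rep.trunk C).cls

/-- The Connes–Kreimer coproduct, extended multiplicatively to forests. -/
def deltaCK : HCK K →ₐ[K] HCK K ⊗[K] HCK K := MvPolynomial.aeval (treeCoproduct K)

/-- The sum `∑_s s ⊗ t/s` over all subforests `s` of the rooted tree `t`. -/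
def treeCoaction (t : RTree) : H K ⊗[K] HCK K :=
  ∑ s : t.rep.Subforest,
    (∏ B ∈ s.1.attach, MvPolynomial.X (s.componentCls B)) ⊗ₜ MvPolynomial.X s.contract.cls

/-- The coaction `Φ` of `H` on the Connes–Kreimer algebra, extended multiplicatively to forests. -/
def coaction : HCK K →ₐ[K] H K ⊗[K] HCK K := MvPolynomial.aeval (treeCoaction K)

/-! ### Graded duals -/

open MvPolynomial in
/-- The graded dual `⨁ₙ (Aₙ)*` of the polynomial algebra `A` on `σ`, graded by giving the variable
`i` the degree `w i`: the linear forms that vanish on `Aₙ` for all large `n`. -/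
def gradedDual {σ : Type*} (w : σ → ℕ) : Submodule K (Module.Dual K (MvPolynomial σ K)) where
  carrier := {α | ∃ N, ∀ n ≥ N, ∀ x ∈ weightedHomogeneousSubmodule K w n, α x = 0}
  zero_mem' := ⟨0, fun _ _ _ _ => rfl⟩
  add_mem' := by
    rintro α β ⟨M, hM⟩ ⟨N, hN⟩
    refine ⟨max M N, fun n hn x hx => ?_⟩
    rw [LinearMap.add_apply, hM n (le_trans (le_max_left _ _) hn) x hx,
      hN n (le_trans (le_max_right _ _) hn) x hx, add_zero]
  smul_mem' := by
    rintro c α ⟨M, hM⟩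
    refine ⟨M, fun n hn x hx => ?_⟩
    rw [LinearMap.smul_apply, hM n hn x hx, smul_zero]

/-- The graded dual of the Connes–Kreimer algebra, graded by the number of vertices. -/
abbrev HCK0 : Submodule K (Module.Dual K (HCK K)) := gradedDual K RTree.vertices

/-- The graded dual of `H`, graded by the number of edges. -/
abbrev H0 : Submodule K (Module.Dual K (H K)) := gradedDual K (fun t : RTree' => t.1.edges)

/-- The convolution product `⟨a ∗ b, x⟩ = ⟨a ⊗ b, Δ_CK x⟩` of linear forms. -/
def conv : Module.Dual K (HCK K) →ₗ[K] Module.Dual K (HCK K) →ₗ[K] Module.Dual K (HCK K) :=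
  TensorProduct.curry
    ((deltaCK K).toLinearMap.dualMap ∘ₗ TensorProduct.dualDistrib K (HCK K) (HCK K))

/-- The product `⟨α ⋆ a, x⟩ = ⟨α ⊗ a, Φ x⟩` of linear forms. -/
def act : Module.Dual K (H K) →ₗ[K] Module.Dual K (HCK K) →ₗ[K] Module.Dual K (HCK K) :=
  TensorProduct.curry
    ((coaction K).toLinearMap.dualMap ∘ₗ TensorProduct.dualDistrib K (H K) (HCK K))

theorem conv_apply (a b : Module.Dual K (HCK K)) (x : HCK K) :
    conv K a b x = TensorProduct.dualDistrib K _ _ (a ⊗ₜ b) (deltaCK K x) := rfl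

theorem act_apply (α : Module.Dual K (H K)) (a : Module.Dual K (HCK K)) (x : HCK K) :
    act K α a x = TensorProduct.dualDistrib K _ _ (α ⊗ₜ a) (coaction K x) := rfl

/-! ### The coproduct of the graded dual of `H` -/

theorem finite_trees (N : ℕ) : {t : RTree | t.vertices ≤ N}.Finite := by
  have hfin : ∀ k : ℕ, Finite (PartialOrder (Fin k)) := fun k =>
    Finite.of_injective (fun p : PartialOrder (Fin k) => p.le) (by
      intro p q h
      refine PartialOrder.ext (fun x y => ?_)
      exact iff_of_eq (congrFun (congrFun h x) y))
  let I : Type := Σ k : Fin (N + 1), {p : PartialOrder (Fin k) × Fin k //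
    (∀ v, p.1.le p.2 v) ∧ ∀ u v w, p.1.le u w → p.1.le v w → p.1.le u v ∨ p.1.le v u}
  have : Finite I := inferInstance
  let g : I → RTree := fun i => FinTree.cls
    { V := Fin i.1
      order := i.2.1.1
      root := i.2.1.2
      root_le := i.2.2.1
      chain := i.2.2.2 }
  refine (Set.finite_range g).subset ?_
  intro t ht
  induction t using Quotient.inductionOn with
  | h t =>
    have ht' : Fintype.card t.V ≤ N := ht
    let e : t.V ≃ Fin (Fintype.card t.V) := Fintype.equivFin t.V
    let p : PartialOrder (Fin (Fintype.card t.V)) := PartialOrder.lift e.symm e.symm.injective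
    refine ⟨⟨⟨Fintype.card t.V, by omega⟩, ⟨(p, e t.root), ?_, ?_⟩⟩, ?_⟩
    · intro v
      change e.symm (e t.root) ≤ e.symm v
      rw [Equiv.symm_apply_apply]
      exact t.root_le _
    · intro u v w
      exact t.chain (e.symm u) (e.symm v) (e.symm w)
    · exact Quotient.sound ⟨⟨e.symm, Iff.rfl⟩⟩

theorem finite_forests (N : ℕ) :
    {m : RTree' →₀ ℕ | Finsupp.weight (fun t : RTree' => t.1.edges) m < N}.Finite := by
  have hT : {t : RTree' | t.1.edges ≤ N}.Finite := by
    refine Set.Finite.of_finite_image (f := fun t : RTree' => t.1) ?_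
      (Subtype.val_injective.injOn)
    refine (finite_trees (N + 1)).subset ?_
    rintro _ ⟨t, ht, rfl⟩
    have : t.1.vertices - 1 ≤ N := ht
    change t.1.vertices ≤ N + 1
    omega
  refine (Finset.finite_toSet (Finset.finsupp hT.toFinset
    (fun _ => Finset.range (N + 1)))).subset ?_
  intro m hm
  have hm' : Finsupp.weight (fun t : RTree' => t.1.edges) m < N := hm
  rw [Finset.mem_coe, Finset.mem_finsupp_iff]
  refine ⟨fun t ht => ?_, fun t _ => ?_⟩
  · rw [Set.Finite.mem_toFinset]
    have := Finsupp.le_weight_of_ne_zero' (fun t : RTree' => t.1.edges)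
      (Finsupp.mem_support_iff.1 ht)
    change t.1.edges ≤ N
    omega
  · have h0 : t.1.edges ≠ 0 := by have := t.2; omega
    have := Finsupp.le_weight (fun t : RTree' => t.1.edges) (s := t) h0 m
    rw [Finset.mem_range]
    omega

/-- The coefficients of `α` in the dual basis of the basis of forests. -/
def coeffs : H0 K →ₗ[K] (RTree' →₀ ℕ) →₀ K where
  toFun α := Finsupp.ofSupportFinite (fun m => α.1 (MvPolynomial.monomial m 1)) (by
    obtain ⟨N, hN⟩ := α.2
    refine (finite_forests N).subset ?_
    intro m hm
    by_contra h
    exact hm (hN _ (not_lt.1 h) _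
      (MvPolynomial.isWeightedHomogeneous_monomial _ _ _ rfl)))
  map_add' α β := by ext m; rfl
  map_smul' c α := by ext m; rfl

/-- The dual basis of the basis of forests of `H`. -/
def dualForest (m : RTree' →₀ ℕ) : H0 K :=
  ⟨MvPolynomial.lcoeff K m, by
    refine ⟨Finsupp.weight (fun t : RTree' => t.1.edges) m + 1, fun n hn x hx => ?_⟩
    by_contra h
    have := (MvPolynomial.mem_weightedHomogeneousSubmodule _ _ _ _).1 hx h
    omega⟩

open scoped Classical in
/-- The coproduct of the graded dual of `H`, dual to the product of `H`
(see `dualDistrib_comul`): the dual basis element of a forest `m` is sent to the sum over all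
decompositions `m = m₁ m₂` of the tensor product of those of `m₁` and `m₂`. -/
def comul : H0 K →ₗ[K] H0 K ⊗[K] H0 K :=
  Finsupp.linearCombination K
    (fun m : RTree' →₀ ℕ =>
      ∑ p ∈ Finset.HasAntidiagonal.antidiagonal m, dualForest K p.1 ⊗ₜ[K] dualForest K p.2) ∘ₗ coeffs K

/-- The coproduct `∑ α₁ ⊗ α₂` of `α` is determined by `∑ α₁(x) α₂(y) = α(x y)`. -/
theorem dualDistrib_comul (α : H0 K) (x y : H K) :
    TensorProduct.dualDistrib K (H K) (H K)
      (TensorProduct.map (H0 K).subtype (H0 K).subtype (comul K α)) (x ⊗ₜ y) = α.1 (x * y) := by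
  classical
  induction x using MvPolynomial.induction_on' with
  | add p q hp hq => rw [TensorProduct.add_tmul, map_add, hp, hq, add_mul, map_add]
  | monomial u c =>
    induction y using MvPolynomial.induction_on' with
    | add p q hp hq => rw [TensorProduct.tmul_add, map_add, hp, hq, mul_add, map_add]
    | monomial v d =>
      have key : ∀ m : RTree' →₀ ℕ, TensorProduct.dualDistrib K (H K) (H K)
          (TensorProduct.map (H0 K).subtype (H0 K).subtype
            (∑ p ∈ Finset.HasAntidiagonal.antidiagonal m, dualForest K p.1 ⊗ₜ[K] dualForest K p.2))
          (MvPolynomial.monomial u c ⊗ₜ MvPolynomial.monomial v d)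
          = if m = u + v then c * d else 0 := by
        intro m
        rw [map_sum, map_sum, LinearMap.sum_apply]
        have : ∀ p : (RTree' →₀ ℕ) × (RTree' →₀ ℕ), TensorProduct.dualDistrib K (H K) (H K)
            (TensorProduct.map (H0 K).subtype (H0 K).subtype
              (dualForest K p.1 ⊗ₜ[K] dualForest K p.2))
            (MvPolynomial.monomial u c ⊗ₜ MvPolynomial.monomial v d)
            = if p = (u, v) then c * d else 0 := by
          rintro ⟨p, q⟩
          change MvPolynomial.coeff p (MvPolynomial.monomial u c) *
            MvPolynomial.coeff q (MvPolynomial.monomial v d) = _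
          rw [MvPolynomial.coeff_monomial, MvPolynomial.coeff_monomial]
          by_cases h1 : u = p <;> by_cases h2 : v = q <;> simp [h1, h2, Prod.ext_iff, eq_comm]
        rw [Finset.sum_congr rfl (fun p _ => this p), Finset.sum_ite_eq']
        simp [Finset.HasAntidiagonal.mem_antidiagonal, eq_comm]
      have hc : ∀ m, coeffs K α m = α.1 (MvPolynomial.monomial m 1) := fun m => rfl
      rw [comul, LinearMap.comp_apply, Finsupp.linearCombination_apply, Finsupp.sum, map_sum,
        map_sum, LinearMap.sum_apply]
      simp only [map_smul, LinearMap.smul_apply, key]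
      have hm : (MvPolynomial.monomial u c * MvPolynomial.monomial v d : H K)
          = (c * d) • MvPolynomial.monomial (u + v) 1 := by
        rw [MvPolynomial.monomial_mul, MvPolynomial.smul_monomial, smul_eq_mul, mul_one]
      rw [hm, map_smul, ← hc]
      simp only [smul_eq_mul, mul_ite, mul_zero, Finset.sum_ite_eq']
      split_ifs with h
      · ring
      · rw [Finsupp.notMem_support_iff.1 h, mul_zero]

/-- For given `a` and `b`, the linear map `α₁ ⊗ α₂ ↦ (α₁ ⋆ a) ∗ (α₂ ⋆ b)`. -/
def actConvAct (a b : Module.Dual K (HCK K)) : H0 K ⊗[K] H0 K →ₗ[K] Module.Dual K (HCK K) :=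
  TensorProduct.lift ((conv K).compl₁₂ ((act K).flip a ∘ₗ (H0 K).subtype)
    ((act K).flip b ∘ₗ (H0 K).subtype))

theorem actConvAct_tmul (a b : Module.Dual K (HCK K)) (α₁ α₂ : H0 K) :
    actConvAct K a b (α₁ ⊗ₜ α₂) = conv K (act K α₁ a) (act K α₂ b) := rfl

/-- Infinitesimal characters of `H`: `α(xy) = α(x) ε(y) + ε(x) α(y)`, where the counit `ε` takes the
constant coefficient. -/
def IsInfinitesimalCharacter (α : Module.Dual K (H K)) : Prop :=
  ∀ x y : H K, α (x * y) =
    α x * MvPolynomial.constantCoeff y + MvPolynomial.constantCoeff x * α y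

end TreeHopf

end

noncomputable section

open scoped Classical

namespace TreeHopf

open MvPolynomial

namespace FinTree

variable {t t' : FinTree}

/-! By duality everything reduces to one identity, `coaction_deltaCK`: (id ⊗ Δ_CK) Φ = m₁₃ (Φ ⊗ Φ)
Δ_CK, where m₁₃ multiplies the two factors in H. Pairing it with α ⊗ a ⊗ b gives the first formula,
because the coproduct of α is dual to that multiplication. An infinitesimal character pairs with
products as α ⊗ ε + ε ⊗ α, and ε acts as the identity (`act_counit`), whence the derivation.

The identity is a bijection of index sets, made plain by working inside one fixed tree. A set S of
vertices with the induced order carries a forest, whose roots are the minima of S. A cut is an upper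
set W of S, giving W ⊗ (S \ W); W = ∅ and W = S supply the two terms with a unit. An edge is named
by its upper vertex, so a subforest is any set E of non-minimal vertices, its contraction is S \ E,
and its components are indexed by S \ E, single vertices counting as 1. Choosing E and then an upper
set U of S \ E amounts to choosing an upper set W of S and then edge sets E₁ in W and E₂ in S \ W
(`sum_contract_cut`): W is the upward closure of U, E = E₁ ∪ E₂, and no component crosses between W
and S \ W (`components_mul`). These sums agree with the defining ones by `treeCoproduct_sub`,
`treeCoaction_sub` and `coaction_forest`.

The products stay in the graded dual because both structure maps preserve degree: contracting |E|
edges leaves |S| - |E| vertices. -/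

/-- The class of the rooted tree carried by a set of vertices with a least element
(with a junk value for the other sets of vertices). -/
def sub (S : Finset t.V) : RTree :=
  if h : ∃ r, IsLeast (S : Set t.V) r then (t.restrict S h.choose h.choose_spec).cls else t.cls

/-- The induced order does not depend on how the least element was obtained. This turns every
`restrict` of the definitions into a `sub`. -/
theorem cls_restrict (S : Finset t.V) (B : Set t.V) (hB : B = S) (r : t.V) (h : IsLeast B r) :
    (t.restrict B r h).cls = sub S := by
  subst hB
  rw [sub, dif_pos ⟨r, h⟩]
  exact Quotient.sound ⟨OrderIso.refl _⟩

theorem sub_map (f : t.V ↪o t'.V) (S : Finset t.V) (hS : ∃ r, IsLeast (S : Set t.V) r) :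
    sub (S.map f.toEmbedding) = sub S := by
  obtain ⟨r, hr⟩ := hS
  have hr' : IsLeast (S.map f.toEmbedding : Set t'.V) (f r) := by
    refine ⟨by simpa using hr.1, ?_⟩
    intro y hy
    obtain ⟨x, hx, rfl⟩ := Finset.mem_map.1 (Finset.mem_coe.1 hy)
    exact f.le_iff_le.2 (hr.2 hx)
  rw [← cls_restrict _ _ rfl _ hr', ← cls_restrict _ _ rfl _ hr]
  have e : (S : Set t.V) ≃o (f '' (S : Set t.V)) :=
    { toEquiv := Equiv.Set.image f _ f.injective
      map_rel_iff' := by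
        rintro ⟨a, ha⟩ ⟨b, hb⟩
        exact f.le_iff_le }
  exact Quotient.sound ⟨((OrderIso.setCongr _ _ (by simp)).trans e.symm)⟩

theorem sub_univ : sub (Finset.univ : Finset t.V) = t.cls := by
  rw [← cls_restrict _ Set.univ (by simp) t.root ⟨trivial, fun v _ => t.root_le v⟩]
  exact Quotient.sound ⟨OrderIso.Set.univ⟩

theorem vertices_sub (S : Finset t.V) (hS : ∃ r, IsLeast (S : Set t.V) r) :
    (sub S).vertices = S.card := by
  obtain ⟨r, hr⟩ := hS
  rw [← cls_restrict _ _ rfl _ hr]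
  change Fintype.card (t.restrict S r hr).V = _
  rw [← Fintype.card_coe]
  exact Fintype.card_congr (Equiv.refl _)

/-! ### Roots, upper sets and components inside a vertex set -/

/-- The minimal elements of a set of vertices. -/
def minima (S : Finset t.V) : Finset t.V := {c ∈ S | ∀ x ∈ S, x ≤ c → x = c}

/-- The part of a set of vertices above a given vertex. -/
def above (S : Finset t.V) (c : t.V) : Finset t.V := {x ∈ S | c ≤ x}

/-- The upper subsets of a set of vertices. -/
def uppers (S : Finset t.V) : Finset (Finset t.V) :=
  {W ∈ S.powerset | ∀ x ∈ W, ∀ y ∈ S, x ≤ y → y ∈ W}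

/-- The component with root `d` when the edges in `E` are kept and all others are removed. -/
def comp (S E : Finset t.V) (d : t.V) : Finset t.V :=
  {x ∈ S | d ≤ x ∧ ∀ y ∈ S, d < y → y ≤ x → y ∈ E}

theorem mem_minima {S : Finset t.V} {c : t.V} :
    c ∈ minima S ↔ c ∈ S ∧ ∀ x ∈ S, x ≤ c → x = c := by simp [minima]

theorem mem_above {S : Finset t.V} {c x : t.V} : x ∈ above S c ↔ x ∈ S ∧ c ≤ x := by simp [above]

theorem mem_uppers {S W : Finset t.V} :
    W ∈ uppers S ↔ W ⊆ S ∧ ∀ x ∈ W, ∀ y ∈ S, x ≤ y → y ∈ W := by simp [uppers]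

theorem mem_comp {S E : Finset t.V} {d x : t.V} :
    x ∈ comp S E d ↔ x ∈ S ∧ d ≤ x ∧ ∀ y ∈ S, d < y → y ≤ x → y ∈ E := by simp [comp]

theorem exists_minima_le {S : Finset t.V} {x : t.V} (hx : x ∈ S) : ∃ c ∈ minima S, c ≤ x := by
  obtain ⟨c, hc, hm⟩ := S.exists_le_minimal hx
  exact ⟨c, mem_minima.2 ⟨hm.1, fun y hy hyc => le_antisymm hyc (hm.2 hy hyc)⟩, hc⟩

/-- Two vertices below x are comparable by `chain`. Hence S splits as a disjoint union of trees, one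
above each minimum. -/
theorem minima_eq_of_le {S : Finset t.V} {c c' x : t.V} (hc : c ∈ minima S) (hc' : c' ∈ minima S)
    (h : c ≤ x) (h' : c' ≤ x) : c = c' := by
  rw [mem_minima] at hc hc'
  rcases t.chain c c' x h h' with h1 | h1
  · exact hc'.2 c hc.1 h1
  · exact (hc.2 c' hc'.1 h1).symm

theorem minima_subset (S : Finset t.V) : minima S ⊆ S := Finset.filter_subset _ _

theorem minima_of_isLeast {S : Finset t.V} {r : t.V} (h : IsLeast (S : Set t.V) r) :
    minima S = {r} := by
  ext c
  rw [mem_minima, Finset.mem_singleton]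
  constructor
  · rintro ⟨h1, h2⟩
    exact (h2 r h.1 (h.2 h1)).symm
  · rintro rfl
    exact ⟨h.1, fun x hx hxc => le_antisymm hxc (h.2 hx)⟩

theorem above_of_isLeast {S : Finset t.V} {r : t.V} (h : IsLeast (S : Set t.V) r) :
    above S r = S :=
  Finset.filter_true_of_mem fun _ hx => h.2 hx

theorem isLeast_above {S : Finset t.V} {c : t.V} (hc : c ∈ S) :
    IsLeast (above S c : Set t.V) c :=
  ⟨mem_above.2 ⟨hc, le_rfl⟩, fun _ hx => (mem_above.1 hx).2⟩

theorem isLeast_comp {S E : Finset t.V} {d : t.V} (hd : d ∈ S) :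
    IsLeast (comp S E d : Set t.V) d :=
  ⟨mem_comp.2 ⟨hd, le_rfl, fun _ _ h h' => (h.not_ge h').elim⟩, fun _ hx => (mem_comp.1 hx).2.1⟩

/-- If d < d' were both roots of components containing x, then d' would lie on the path from d to x
and so be an edge of E. -/
theorem comp_eq_of_mem {S E : Finset t.V} {d d' x : t.V} (hd : d ∈ S \ E) (hd' : d' ∈ S \ E)
    (h : x ∈ comp S E d) (h' : x ∈ comp S E d') : d = d' := by
  rw [Finset.mem_sdiff] at hd hd'
  rw [mem_comp] at h h'
  by_contra hne
  rcases t.chain d d' x h.2.1 h'.2.1 with h1 | h1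
  · exact hd'.2 (h.2.2 d' hd'.1 (lt_of_le_of_ne h1 hne) h'.2.1)
  · exact hd.2 (h'.2.2 d hd.1 (lt_of_le_of_ne h1 (Ne.symm hne)) h.2.1)

theorem exists_mem_comp {S E : Finset t.V} (hE : E ⊆ S \ minima S) {x : t.V} (hx : x ∈ S) :
    ∃ d ∈ S \ E, x ∈ comp S E d := by
  obtain ⟨c, hc, hcx⟩ := exists_minima_le hx
  -- The root of the component of x is the highest vertex of S \ E below x; one exists because E
  -- avoids the minima.
  have hcT : c ∈ (S \ E).filter (· ≤ x) := Finset.mem_filter.2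
    ⟨Finset.mem_sdiff.2 ⟨minima_subset _ hc, fun h => (Finset.mem_sdiff.1 (hE h)).2 hc⟩, hcx⟩
  obtain ⟨d, -, hd⟩ := Finset.exists_le_maximal _ hcT
  have hd1 := Finset.mem_filter.1 hd.1
  refine ⟨d, hd1.1, mem_comp.2 ⟨hx, hd1.2, fun y hy hdy hyx => ?_⟩⟩
  by_contra hyE
  exact hdy.not_ge (hd.2 (Finset.mem_filter.2 ⟨Finset.mem_sdiff.2 ⟨hy, hyE⟩, hyx⟩) hdy.le)

/-! ### Monomials and sums attached to a vertex set -/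

variable (K : Type*) [Field K]

/-- The monomial of the forest carried by a set of vertices. -/
def forest (S : Finset t.V) : HCK K := ∏ c ∈ minima S, X (sub (above S c))

/-- The variable of the tree carried by `B`, where the one-vertex tree gives the unit. -/
def compVar (B : Finset t.V) : H K :=
  if h : 1 ≤ (sub B).edges then X (⟨sub B, h⟩ : RTree') else 1

/-- The monomial of the subforest with set of edges `E`. -/
def components (S E : Finset t.V) : H K := ∏ d ∈ S \ E, compVar K (comp S E d)

/-- The sum over all upper sets that gives the coproduct of a forest. -/
def coprodSum (S : Finset t.V) : HCK K ⊗[K] HCK K :=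
  ∑ W ∈ uppers S, forest K W ⊗ₜ forest K (S \ W)

/-- The sum over all sets of edges that gives the coaction on a forest. -/
def coactSum (S : Finset t.V) : H K ⊗[K] HCK K :=
  ∑ E ∈ (S \ minima S).powerset, components K S E ⊗ₜ forest K (S \ E)

theorem forest_of_isLeast {S : Finset t.V} {r : t.V} (h : IsLeast (S : Set t.V) r) :
    forest K S = X (sub S) := by
  rw [forest, minima_of_isLeast h, Finset.prod_singleton, above_of_isLeast h]

theorem forest_empty : forest K (∅ : Finset t.V) = 1 := by simp [forest, minima]

/-! ### Transport along order embeddings -/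

variable (f : t.V ↪o t'.V)

theorem minima_map (S : Finset t.V) :
    minima (S.map f.toEmbedding) = (minima S).map f.toEmbedding := by
  ext x
  simp only [mem_minima, Finset.mem_map]
  constructor
  · rintro ⟨⟨c, hc, rfl⟩, h⟩
    exact ⟨c, ⟨hc, fun x hx hxc => f.injective (h (f x) ⟨x, hx, rfl⟩ (f.le_iff_le.2 hxc))⟩, rfl⟩
  · rintro ⟨c, ⟨hc, h⟩, rfl⟩
    refine ⟨⟨c, hc, rfl⟩, ?_⟩
    rintro _ ⟨x, hx, rfl⟩ hxc
    exact congrArg f (h x hx (f.le_iff_le.1 hxc))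

theorem above_map (S : Finset t.V) (c : t.V) :
    above (S.map f.toEmbedding) (f c) = (above S c).map f.toEmbedding := by
  ext x
  simp only [mem_above, Finset.mem_map]
  constructor
  · rintro ⟨⟨x, hx, rfl⟩, h⟩
    exact ⟨x, ⟨hx, f.le_iff_le.1 h⟩, rfl⟩
  · rintro ⟨x, ⟨hx, h⟩, rfl⟩
    exact ⟨⟨x, hx, rfl⟩, f.le_iff_le.2 h⟩

theorem comp_map (S E : Finset t.V) (d : t.V) :
    comp (S.map f.toEmbedding) (E.map f.toEmbedding) (f d) = (comp S E d).map f.toEmbedding := by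
  ext x
  simp only [mem_comp, Finset.mem_map]
  constructor
  · rintro ⟨⟨x, hx, rfl⟩, h, h'⟩
    refine ⟨x, ⟨hx, f.le_iff_le.1 h, fun y hy h1 h2 => ?_⟩, rfl⟩
    obtain ⟨z, hz, hzy⟩ := h' (f y) ⟨y, hy, rfl⟩ (f.lt_iff_lt.2 h1) (f.le_iff_le.2 h2)
    exact f.injective hzy ▸ hz
  · rintro ⟨x, ⟨hx, h, h'⟩, rfl⟩
    refine ⟨⟨x, hx, rfl⟩, f.le_iff_le.2 h, ?_⟩
    rintro _ ⟨y, hy, rfl⟩ h1 h2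
    exact ⟨y, h' y hy (f.lt_iff_lt.1 h1) (f.le_iff_le.1 h2), rfl⟩

theorem forest_map (S : Finset t.V) : forest K (S.map f.toEmbedding) = forest K S := by
  rw [forest, minima_map, Finset.prod_map, forest]
  refine Finset.prod_congr rfl fun c hc => ?_
  have := above_map f S c
  rw [RelEmbedding.coe_toEmbedding, this, sub_map _ _ ⟨c, isLeast_above (minima_subset _ hc)⟩]

theorem compVar_map (B : Finset t.V) (hB : ∃ r, IsLeast (B : Set t.V) r) :
    compVar K (B.map f.toEmbedding) = compVar K B := by
  simp only [compVar, sub_map f B hB]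

theorem map_sdiff_map (S E : Finset t.V) :
    S.map f.toEmbedding \ E.map f.toEmbedding = (S \ E).map f.toEmbedding := by
  ext x; simp only [Finset.mem_sdiff, Finset.mem_map]; grind

theorem components_map (S E : Finset t.V) :
    components K (S.map f.toEmbedding) (E.map f.toEmbedding) = components K S E := by
  rw [components, map_sdiff_map, Finset.prod_map, components]
  refine Finset.prod_congr rfl fun d hd => ?_
  have h := comp_map f S E d
  rw [RelEmbedding.coe_toEmbedding, h,
    compVar_map _ _ _ ⟨d, isLeast_comp (Finset.mem_sdiff.1 hd).1⟩]

theorem powerset_map (S : Finset t.V) : (S.map f.toEmbedding).powerset =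
    S.powerset.map (Finset.mapEmbedding f.toEmbedding).toEmbedding := by
  ext E
  simp only [Finset.mem_powerset, Finset.mem_map, Finset.subset_map_iff]
  constructor
  · rintro ⟨u, hu, rfl⟩; exact ⟨u, hu, rfl⟩
  · rintro ⟨u, hu, rfl⟩; exact ⟨u, hu, rfl⟩

theorem uppers_map (S : Finset t.V) : uppers (S.map f.toEmbedding) =
    (uppers S).map (Finset.mapEmbedding f.toEmbedding).toEmbedding := by
  rw [uppers, powerset_map, Finset.filter_map, uppers]
  congr 1
  refine Finset.filter_congr fun W _ => ?_
  simp only [Function.comp_apply, RelEmbedding.coe_toEmbedding, Finset.mapEmbedding_apply,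
    Finset.forall_mem_map, f.le_iff_le]
  have h : ∀ x, f x ∈ W.map f.toEmbedding ↔ x ∈ W := fun x => Finset.mem_map' f.toEmbedding
  simp only [h]

theorem coprodSum_map (S : Finset t.V) :
    coprodSum K (S.map f.toEmbedding) = coprodSum K S := by
  rw [coprodSum, uppers_map, Finset.sum_map, coprodSum]
  refine Finset.sum_congr rfl fun W _ => ?_
  rw [RelEmbedding.coe_toEmbedding, Finset.mapEmbedding_apply, map_sdiff_map, forest_map, forest_map]

theorem coactSum_map (S : Finset t.V) :
    coactSum K (S.map f.toEmbedding) = coactSum K S := by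
  rw [coactSum, minima_map, map_sdiff_map, powerset_map, Finset.sum_map, coactSum]
  refine Finset.sum_congr rfl fun W _ => ?_
  rw [RelEmbedding.coe_toEmbedding, Finset.mapEmbedding_apply, map_sdiff_map, components_map,
    forest_map]

/-- Together with invariance under order embeddings, this makes the choice of representatives in the
definitions harmless. -/
theorem exists_embedding_rep (S : Finset t.V) (hS : ∃ r, IsLeast (S : Set t.V) r) :
    ∃ f : (sub S).rep.V ↪o t.V, Finset.univ.map f.toEmbedding = S := by
  obtain ⟨r, hr⟩ := hS
  rw [← cls_restrict _ _ rfl _ hr]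
  obtain ⟨e⟩ : (t.restrict S r hr).cls.rep ≈ t.restrict S r hr := Quotient.mk_out _
  refine ⟨e.toOrderEmbedding.trans (OrderEmbedding.subtype (· ∈ (S : Set t.V))), ?_⟩
  ext x
  simp only [Finset.mem_map, Finset.mem_univ, true_and]
  constructor
  · rintro ⟨y, rfl⟩
    exact (e y).2
  · intro hx
    exact ⟨e.symm ⟨x, hx⟩, congrArg Subtype.val (e.apply_symm_apply ⟨x, hx⟩)⟩

end FinTree

namespace FinTree

variable {t : FinTree} (K : Type*) [Field K]

/-! ### The coproduct of a tree -/

theorem isLeast_univ : IsLeast ((Finset.univ : Finset t.V) : Set t.V) t.root :=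
  ⟨by simp, fun v _ => t.root_le v⟩

/-- An upper set containing the root is everything. The first two cases give the terms 1 ⊗ t and t ⊗
1, the third the admissible cuts. -/
theorem uppers_univ : uppers (Finset.univ : Finset t.V) =
    insert ∅ (insert Finset.univ {W ∈ uppers Finset.univ | W.Nonempty ∧ t.root ∉ W}) := by
  ext W
  simp only [Finset.mem_insert, Finset.mem_filter, mem_uppers]
  constructor
  · intro h
    rcases W.eq_empty_or_nonempty with h0 | h0
    · exact Or.inl h0
    · by_cases h1 : t.root ∈ W
      · refine Or.inr (Or.inl (Finset.eq_univ_of_forall fun v => ?_))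
        exact h.2 _ h1 v (Finset.mem_univ _) (t.root_le v)
      · exact Or.inr (Or.inr ⟨h, h0, h1⟩)
  · rintro (rfl | rfl | h)
    · simp
    · simp
    · exact h.1

/-- The upper set cut off by an admissible cut. -/
def cutSet (C : Finset t.V) : Finset t.V := {v | ∃ c ∈ C, c ≤ v}

theorem mem_cutSet {C : Finset t.V} {v : t.V} : v ∈ cutSet C ↔ ∃ c ∈ C, c ≤ v := by simp [cutSet]

theorem minima_cutSet {C : Finset t.V} (hC : t.IsAdmissibleCut C) : minima (cutSet C) = C := by
  ext c
  rw [mem_minima, mem_cutSet]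
  constructor
  · rintro ⟨⟨d, hd, hdc⟩, h⟩
    exact h d (mem_cutSet.2 ⟨d, hd, le_rfl⟩) hdc ▸ hd
  · intro hc
    refine ⟨⟨c, hc, le_rfl⟩, fun x hx hxc => ?_⟩
    obtain ⟨d, hd, hdx⟩ := mem_cutSet.1 hx
    have := hC.2.2 c d hd c hc (hdx.trans hxc) le_rfl
    exact le_antisymm hxc (this ▸ hdx)

/-- Cuts are antichains of non-root vertices, hence correspond to the non-empty upper sets without
the root, through `minima` and `cutSet`. -/
theorem isAdmissibleCut_minima {W : Finset t.V} (hW : W.Nonempty) (hr : t.root ∉ W) :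
    t.IsAdmissibleCut (minima W) := by
  refine ⟨?_, fun h => hr (minima_subset _ h), fun v c hc c' hc' h h' => minima_eq_of_le hc hc' h h'⟩
  obtain ⟨x, hx⟩ := hW
  obtain ⟨c, hc, -⟩ := exists_minima_le hx
  exact ⟨c, hc⟩

theorem cutSet_minima {W : Finset t.V} (hW : W ∈ uppers Finset.univ) : cutSet (minima W) = W := by
  ext v
  rw [mem_cutSet]
  constructor
  · rintro ⟨c, hc, hcv⟩
    exact (mem_uppers.1 hW).2 c (minima_subset _ hc) v (Finset.mem_univ _) hcv
  · intro hv
    exact exists_minima_le hv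

theorem cutSet_mem_uppers (C : Finset t.V) : cutSet C ∈ uppers Finset.univ :=
  mem_uppers.2 ⟨Finset.subset_univ _, fun x hx y _ hxy => by
    obtain ⟨c, hc, hcx⟩ := mem_cutSet.1 hx
    exact mem_cutSet.2 ⟨c, hc, hcx.trans hxy⟩⟩

theorem prod_branch (C : t.AdmissibleCut) :
    ∏ c ∈ C.1, (X (t.branch c).cls : HCK K) = forest K (cutSet C.1) := by
  rw [forest, minima_cutSet C.2]
  refine Finset.prod_congr rfl fun c hc => ?_
  refine congrArg X (cls_restrict (above (cutSet C.1) c) _ ?_ _ _)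
  ext v
  simp only [Set.mem_Ici, Finset.mem_coe, mem_above, mem_cutSet]
  exact ⟨fun h => ⟨⟨c, hc, h⟩, h⟩, fun h => h.2⟩

theorem cls_trunk (C : t.AdmissibleCut) :
    (t.trunk C).cls = sub (Finset.univ \ cutSet C.1) := by
  refine cls_restrict _ _ ?_ _ _
  ext v
  simp [mem_cutSet]

theorem isLeast_compl_root {W : Finset t.V} (h : t.root ∉ W) :
    IsLeast ((Finset.univ \ W : Finset t.V) : Set t.V) t.root :=
  ⟨by simpa using h, fun v _ => t.root_le v⟩

theorem coprodSum_univ : coprodSum K (Finset.univ : Finset t.V) =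
    1 ⊗ₜ X t.cls + X t.cls ⊗ₜ 1 + ∑ C : t.AdmissibleCut,
      (∏ c ∈ C.1, (X (t.branch c).cls : HCK K)) ⊗ₜ[K] (X (t.trunk C).cls : HCK K) := by
  have hne : (Finset.univ : Finset t.V).Nonempty := ⟨t.root, Finset.mem_univ _⟩
  rw [coprodSum, uppers_univ, Finset.sum_insert, Finset.sum_insert, Finset.sdiff_empty,
    Finset.sdiff_self, forest_empty, forest_of_isLeast K isLeast_univ, sub_univ, ← add_assoc]
  · congr 1
    symm
    refine Finset.sum_bij' (fun C _ => cutSet C.1)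
      (fun W hW => ⟨minima W, isAdmissibleCut_minima (Finset.mem_filter.1 hW).2.1
        (Finset.mem_filter.1 hW).2.2⟩) ?_ ?_ ?_ ?_ ?_
    · intro C _
      refine Finset.mem_filter.2 ⟨cutSet_mem_uppers _, ?_, ?_⟩
      · obtain ⟨c, hc⟩ := C.2.1
        exact ⟨c, mem_cutSet.2 ⟨c, hc, le_rfl⟩⟩
      · intro h
        obtain ⟨c, hc, hcr⟩ := mem_cutSet.1 h
        exact C.2.2.1 (le_antisymm hcr (t.root_le c) ▸ hc)
    · intro W _
      exact Finset.mem_univ _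
    · intro C _
      exact Subtype.ext (minima_cutSet C.2)
    · intro W hW
      exact cutSet_minima (Finset.mem_filter.1 hW).1
    · intro C _
      have hr : t.root ∉ cutSet C.1 := by
        intro h
        obtain ⟨c, hc, hcr⟩ := mem_cutSet.1 h
        exact C.2.2.1 (le_antisymm hcr (t.root_le c) ▸ hc)
      rw [prod_branch, cls_trunk, forest_of_isLeast K (isLeast_compl_root hr)]
  · simp
  · rw [Finset.mem_insert, not_or]
    exact ⟨hne.ne_empty.symm, by simp⟩

theorem cls_rep (T : RTree) : T.rep.cls = T := Quotient.out_eq T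

theorem treeCoproduct_sub (S : Finset t.V) (hS : ∃ r, IsLeast (S : Set t.V) r) :
    treeCoproduct K (sub S) = coprodSum K S := by
  obtain ⟨f, hf⟩ := exists_embedding_rep S hS
  conv_rhs => rw [← hf]
  rw [coprodSum_map, coprodSum_univ, cls_rep, treeCoproduct]

/-! ### Coassociativity on forests of vertices -/

theorem mem_upClosure {S U : Finset t.V} {x : t.V} :
    x ∈ S.filter (fun x => ∃ u ∈ U, u ≤ x) ↔ x ∈ S ∧ ∃ u ∈ U, u ≤ x := by simp

/-- Since U is already an upper set of S \ E, closing it upwards in S adds contracted vertices only.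
-/
theorem upClosure_sdiff {S E U : Finset t.V} (hU : U ⊆ S \ E)
    (hup : ∀ x ∈ U, ∀ y ∈ S \ E, x ≤ y → y ∈ U) :
    S.filter (fun x => ∃ u ∈ U, u ≤ x) \ (E ∩ S.filter (fun x => ∃ u ∈ U, u ≤ x)) = U := by
  ext x
  simp only [Finset.mem_sdiff, Finset.mem_inter, mem_upClosure]
  constructor
  · rintro ⟨⟨hx, u, hu, hux⟩, h3⟩
    exact hup u hu x (Finset.mem_sdiff.2 ⟨hx, fun h => h3 ⟨h, hx, u, hu, hux⟩⟩) hux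
  · intro hx
    have := Finset.mem_sdiff.1 (hU hx)
    exact ⟨⟨this.1, x, hx, le_rfl⟩, fun h => this.2 h.1⟩

theorem above_minima_disjoint {S : Finset t.V} : Set.PairwiseDisjoint (minima S : Set t.V)
    (above S) := by
  intro c hc c' hc' hne
  rw [Function.onFun, Finset.disjoint_left]
  intro x hx hx'
  exact hne (minima_eq_of_le hc hc' (mem_above.1 hx).2 (mem_above.1 hx').2)

/-- Splitting the components of a subforest along an upper set that cuts none of them. -/
theorem components_mul {S W E₁ E₂ : Finset t.V} (hW : W ∈ uppers S) (h₁ : E₁ ⊆ W \ minima W)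
    (h₂ : E₂ ⊆ (S \ W) \ minima (S \ W)) :
    components K S (E₁ ∪ E₂) = components K W E₁ * components K (S \ W) E₂ := by
  rw [mem_uppers] at hW
  have hd : Disjoint (W \ E₁) ((S \ W) \ E₂) := by
    rw [Finset.disjoint_left]; intro x; simp only [Finset.mem_sdiff]; tauto
  have hu : S \ (E₁ ∪ E₂) = (W \ E₁) ∪ ((S \ W) \ E₂) := by
    ext x
    have a1 := @h₁ x
    have a2 := @h₂ x
    have a3 := @hW.1 x
    simp only [Finset.mem_sdiff, Finset.mem_union] at a1 a2 ⊢
    tauto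
  rw [components, hu, Finset.prod_union hd, components, components]
  congr 1
  · refine Finset.prod_congr rfl fun d hd => congrArg _ ?_
    rw [Finset.mem_sdiff] at hd
    ext x
    rw [mem_comp, mem_comp]
    constructor
    · rintro ⟨hx, hdx, h⟩
      refine ⟨hW.2 d hd.1 x hx hdx, hdx, fun y hy h3 h4 => ?_⟩
      rcases Finset.mem_union.1 (h y (hW.1 hy) h3 h4) with h5 | h5
      · exact h5
      · exact absurd hy (Finset.mem_sdiff.1 (Finset.mem_sdiff.1 (h₂ h5)).1).2
    · rintro ⟨hx, hdx, h⟩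
      exact ⟨hW.1 hx, hdx, fun y hy h3 h4 =>
        Finset.mem_union_left _ (h y (hW.2 d hd.1 y hy h3.le) h3 h4)⟩
  · refine Finset.prod_congr rfl fun d hd => congrArg _ ?_
    rw [Finset.mem_sdiff, Finset.mem_sdiff] at hd
    ext x
    rw [mem_comp, mem_comp]
    constructor
    · rintro ⟨hx, hdx, h⟩
      -- A component rooted outside W cannot enter W: it would do so through a minimum c of W lying
      -- strictly above d, so c would be in E₁ ∪ E₂, yet E₁ avoids the minima of W and E₂ avoids W.
      have hxW : x ∉ W := by
        intro hxW
        obtain ⟨c, hc, hcx⟩ := exists_minima_le hxW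
        have hcW := minima_subset _ hc
        rcases t.chain c d x hcx hdx with h5 | h5
        · exact hd.1.2 (hW.2 c hcW d hd.1.1 h5)
        · have hlt : d < c := lt_of_le_of_ne h5 (by rintro rfl; exact hd.1.2 hcW)
          rcases Finset.mem_union.1 (h c (hW.1 hcW) hlt hcx) with h6 | h6
          · exact (Finset.mem_sdiff.1 (h₁ h6)).2 hc
          · exact (Finset.mem_sdiff.1 (Finset.mem_sdiff.1 (h₂ h6)).1).2 hcW
      refine ⟨Finset.mem_sdiff.2 ⟨hx, hxW⟩, hdx, fun y hy h3 h4 => ?_⟩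
      rcases Finset.mem_union.1 (h y (Finset.mem_sdiff.1 hy).1 h3 h4) with h5 | h5
      · exact absurd (Finset.mem_sdiff.1 (h₁ h5)).1 (Finset.mem_sdiff.1 hy).2
      · exact h5
    · rintro ⟨hx, hdx, h⟩
      rw [Finset.mem_sdiff] at hx
      refine ⟨hx.1, hdx, fun y hy h3 h4 => Finset.mem_union_right _ (h y ?_ h3 h4)⟩
      exact Finset.mem_sdiff.2 ⟨hy, fun hyW => hx.2 (hW.2 y hyW x hx.1 h4)⟩

/-- The bijection between a contraction followed by a cut and a cut followed by two
contractions. -/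
theorem sum_contract_cut {M : Type*} [AddCommMonoid M] (S : Finset t.V)
    (F : Finset t.V → Finset t.V → Finset t.V → M) :
    ∑ E ∈ (S \ minima S).powerset, ∑ U ∈ uppers (S \ E), F E U ((S \ E) \ U) =
    ∑ W ∈ uppers S, ∑ E₁ ∈ (W \ minima W).powerset,
      ∑ E₂ ∈ ((S \ W) \ minima (S \ W)).powerset, F (E₁ ∪ E₂) (W \ E₁) ((S \ W) \ E₂) := by
  simp_rw [← Finset.sum_product']
  rw [Finset.sum_sigma', Finset.sum_sigma']
  -- W is the upward closure of U in S, and E is split into its parts inside and outside W;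
  -- conversely E = E₁ ∪ E₂ and U = W \ E₁.
  refine Finset.sum_bij'
    (fun p _ => ⟨S.filter (fun x => ∃ u ∈ p.2, u ≤ x),
      (p.1 ∩ S.filter (fun x => ∃ u ∈ p.2, u ≤ x), p.1 \ S.filter (fun x => ∃ u ∈ p.2, u ≤ x))⟩)
    (fun q _ => ⟨q.2.1 ∪ q.2.2, q.1 \ q.2.1⟩) ?_ ?_ ?_ ?_ ?_
  · rintro ⟨E, U⟩ h
    simp only [Finset.mem_sigma, Finset.mem_powerset, mem_uppers] at h
    obtain ⟨hE, hU, hup⟩ := h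
    simp only [Finset.mem_sigma, Finset.mem_product, Finset.mem_powerset, mem_uppers]
    refine ⟨⟨Finset.filter_subset _ _, ?_⟩, ?_, ?_⟩
    · intro x hx y hy hxy
      rw [mem_upClosure] at hx ⊢
      obtain ⟨hx, u, hu, hux⟩ := hx
      exact ⟨hy, u, hu, hux.trans hxy⟩
    · intro x hx
      obtain ⟨hxE, hxW⟩ := Finset.mem_inter.1 hx
      refine Finset.mem_sdiff.2 ⟨hxW, fun hm => ?_⟩
      obtain ⟨hxS, u, hu, hux⟩ := mem_upClosure.1 hxW
      -- A minimum of W lies in U, hence outside E.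
      have hu' := Finset.mem_sdiff.1 (hU hu)
      have := (mem_minima.1 hm).2 u (mem_upClosure.2 ⟨hu'.1, u, hu, le_rfl⟩) hux
      exact hu'.2 (this ▸ hxE)
    · intro x hx
      obtain ⟨hxE, hxW⟩ := Finset.mem_sdiff.1 hx
      have hxS := Finset.mem_sdiff.1 (hE hxE)
      refine Finset.mem_sdiff.2 ⟨Finset.mem_sdiff.2 ⟨hxS.1, hxW⟩, fun hm => hxS.2 ?_⟩
      -- The complement of an upper set is closed downwards, so its minima are minima of S.
      refine mem_minima.2 ⟨hxS.1, fun y hy hyx => (mem_minima.1 hm).2 y ?_ hyx⟩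
      refine Finset.mem_sdiff.2 ⟨hy, fun hyW => hxW ?_⟩
      obtain ⟨-, u, hu, huy⟩ := mem_upClosure.1 hyW
      exact mem_upClosure.2 ⟨hxS.1, u, hu, huy.trans hyx⟩
  · rintro ⟨W, E₁, E₂⟩ h
    simp only [Finset.mem_sigma, Finset.mem_product, Finset.mem_powerset, mem_uppers] at h
    obtain ⟨⟨hW, hup⟩, h₁, h₂⟩ := h
    simp only [Finset.mem_sigma, Finset.mem_powerset, mem_uppers]
    refine ⟨?_, ?_, ?_⟩
    · intro x hx
      rcases Finset.mem_union.1 hx with hx | hx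
      · obtain ⟨h3, h4⟩ := Finset.mem_sdiff.1 (h₁ hx)
        refine Finset.mem_sdiff.2 ⟨hW h3, fun hm => h4 ?_⟩
        exact mem_minima.2 ⟨h3, fun y hy => (mem_minima.1 hm).2 y (hW hy)⟩
      · obtain ⟨h3, h4⟩ := Finset.mem_sdiff.1 (h₂ hx)
        refine Finset.mem_sdiff.2 ⟨(Finset.mem_sdiff.1 h3).1, fun hm => h4 ?_⟩
        exact mem_minima.2 ⟨h3, fun y hy => (mem_minima.1 hm).2 y (Finset.mem_sdiff.1 hy).1⟩
    · intro x hx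
      obtain ⟨hxW, hx1⟩ := Finset.mem_sdiff.1 hx
      refine Finset.mem_sdiff.2 ⟨hW hxW, fun hxu => ?_⟩
      rcases Finset.mem_union.1 hxu with h | h
      · exact hx1 h
      · exact (Finset.mem_sdiff.1 (Finset.mem_sdiff.1 (h₂ h)).1).2 hxW
    · intro x hx y hy hxy
      have hy' := Finset.mem_sdiff.1 hy
      exact Finset.mem_sdiff.2 ⟨hup x (Finset.mem_sdiff.1 hx).1 y hy'.1 hxy,
        fun h => hy'.2 (Finset.mem_union_left _ h)⟩
  · rintro ⟨E, U⟩ h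
    simp only [Finset.mem_sigma, Finset.mem_powerset, mem_uppers] at h
    obtain ⟨hE, hU, hup⟩ := h
    have h1 := upClosure_sdiff hU hup
    have h2 : E ∩ S.filter (fun x => ∃ u ∈ U, u ≤ x) ∪ E \ S.filter (fun x => ∃ u ∈ U, u ≤ x) = E :=
      by ext x; simp only [Finset.mem_sdiff, Finset.mem_inter, Finset.mem_union]; tauto
    simp only [h1, h2]
  · rintro ⟨W, E₁, E₂⟩ h
    simp only [Finset.mem_sigma, Finset.mem_product, Finset.mem_powerset, mem_uppers] at h
    obtain ⟨⟨hW, hup⟩, h₁, h₂⟩ := h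
    -- E₁ avoids the minima of W, so they survive in W \ E₁ and generate W upwards.
    have h0 : S.filter (fun x => ∃ u ∈ W \ E₁, u ≤ x) = W := by
      ext x
      rw [mem_upClosure]
      constructor
      · rintro ⟨hx, u, hu, hux⟩
        exact hup u (Finset.mem_sdiff.1 hu).1 x hx hux
      · intro hx
        obtain ⟨c, hc, hcx⟩ := exists_minima_le hx
        exact ⟨hW hx, c, Finset.mem_sdiff.2 ⟨minima_subset _ hc,
          fun h => (Finset.mem_sdiff.1 (h₁ h)).2 hc⟩, hcx⟩
    have h1 : (E₁ ∪ E₂) ∩ W = E₁ := by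
      ext x
      have a1 := @h₁ x
      have a2 := @h₂ x
      simp only [Finset.mem_sdiff, Finset.mem_inter, Finset.mem_union] at a1 a2 ⊢
      tauto
    have h2 : (E₁ ∪ E₂) \ W = E₂ := by
      ext x
      have a1 := @h₁ x
      have a2 := @h₂ x
      simp only [Finset.mem_sdiff, Finset.mem_union] at a1 a2 ⊢
      tauto
    simp only [h0, h1, h2]
  · rintro ⟨E, U⟩ h
    simp only [Finset.mem_sigma, Finset.mem_powerset, mem_uppers] at h
    obtain ⟨hE, hU, hup⟩ := h
    have h1 := upClosure_sdiff hU hup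
    have h2 : E ∩ S.filter (fun x => ∃ u ∈ U, u ≤ x) ∪ E \ S.filter (fun x => ∃ u ∈ U, u ≤ x) = E :=
      by ext x; simp only [Finset.mem_sdiff, Finset.mem_inter, Finset.mem_union]; tauto
    have h3 : (S \ S.filter (fun x => ∃ u ∈ U, u ≤ x)) \
        (E \ S.filter (fun x => ∃ u ∈ U, u ≤ x)) = (S \ E) \ U := by
      ext x
      have h4 := Finset.ext_iff.1 h1 x
      simp only [Finset.mem_sdiff, Finset.mem_inter] at h4 ⊢
      tauto
    simp only [h1, h2, h3]

end FinTree

/-! ### Expanding a product of sums over subsets -/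

/-- A choice of one subset in each of several disjoint sets is a single subset of their union,
recovered by intersecting. -/
theorem prod_sum_powerset {ι α R : Type*} [CommSemiring R] (C : Finset ι)
    (A : ι → Finset α) (hA : (C : Set ι).PairwiseDisjoint A) (f : ι → Finset α → R) :
    ∏ c ∈ C, ∑ E ∈ (A c).powerset, f c E =
      ∑ E ∈ (C.biUnion A).powerset, ∏ c ∈ C, f c (E ∩ A c) := by
  induction C using Finset.induction_on with
  | empty => simp
  | insert c C hc ih =>
    rw [Finset.prod_insert hc, ih (hA.subset (by simp)), Finset.sum_mul_sum,
      ← Finset.sum_product', Finset.biUnion_insert]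
    have hd : Disjoint (A c) (C.biUnion A) := by
      rw [Finset.disjoint_biUnion_right]
      intro d hd
      exact hA (by simp) (by simp [hd]) (by rintro rfl; exact hc hd)
    rw [Finset.disjoint_left] at hd
    refine Finset.sum_bij' (fun p _ => p.1 ∪ p.2) (fun E _ => (E ∩ A c, E ∩ C.biUnion A))
      ?_ ?_ ?_ ?_ ?_
    · rintro ⟨E, F⟩ h
      simp only [Finset.mem_product, Finset.mem_powerset] at h ⊢
      exact Finset.union_subset_union h.1 h.2
    · intro E _
      simp only [Finset.mem_product, Finset.mem_powerset]
      exact ⟨Finset.inter_subset_right, Finset.inter_subset_right⟩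
    · rintro ⟨E, F⟩ h
      simp only [Finset.mem_product, Finset.mem_powerset] at h
      refine Prod.ext ?_ ?_
      all_goals
        ext x
        have a1 := @h.1 x
        have a2 := @h.2 x
        have a3 := @hd x
        simp only [Finset.mem_inter, Finset.mem_union]
        tauto
    · intro E h
      rw [Finset.mem_powerset] at h
      change E ∩ A c ∪ E ∩ C.biUnion A = E
      rw [← Finset.inter_union_distrib_left, Finset.inter_eq_left.2 h]
    · rintro ⟨E, F⟩ h
      simp only [Finset.mem_product, Finset.mem_powerset] at h
      rw [Finset.prod_insert hc]
      congr 1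
      · congr 1
        ext x
        have a1 := @h.1 x
        have a2 := @h.2 x
        have a3 := @hd x
        simp only [Finset.mem_inter, Finset.mem_union]
        tauto
      · refine Finset.prod_congr rfl fun d hdC => congrArg _ ?_
        ext x
        have a1 := @h.1 x
        have a3 := @hd x
        have a4 : x ∈ A d → x ∈ C.biUnion A := fun h => Finset.mem_biUnion.2 ⟨d, hdC, h⟩
        simp only [Finset.mem_inter, Finset.mem_union]
        tauto

namespace FinTree

variable {t : FinTree} (K : Type*) [Field K]

/-! ### Subforests and sets of edges -/

/-- The edges of a set of subtrees, named by their upper vertices. -/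
def edgeSet (s : Finset (Finset t.V)) : Finset t.V :=
  {v | ∃ B ∈ s, v ∈ B ∧ ¬ IsLeast (B : Set t.V) v}

/-- The subtrees with at least one edge that are spanned by a set of edges. -/
def ofEdges (E : Finset t.V) : Finset (Finset t.V) :=
  ((Finset.univ \ E).filter fun d => 2 ≤ (comp Finset.univ E d).card).image (comp Finset.univ E)

theorem mem_edgeSet {s : Finset (Finset t.V)} {v : t.V} :
    v ∈ edgeSet s ↔ ∃ B ∈ s, v ∈ B ∧ ¬ IsLeast (B : Set t.V) v := by simp [edgeSet]

theorem mem_ofEdges {E B : Finset t.V} :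
    B ∈ ofEdges E ↔ ∃ d ∉ E, 2 ≤ (comp Finset.univ E d).card ∧ comp Finset.univ E d = B := by
  simp [ofEdges, and_assoc]

theorem isSubforest_ofEdges (E : Finset t.V) : t.IsSubforest (ofEdges E) := by
  refine ⟨fun B hB => ?_, fun B hB B' hB' hne => ?_⟩
  · obtain ⟨d, hd, h2, rfl⟩ := mem_ofEdges.1 hB
    refine ⟨d, h2, isLeast_comp (Finset.mem_univ _), fun w hw x hdx hxw => ?_⟩
    exact mem_comp.2 ⟨Finset.mem_univ _, hdx, fun y hy h3 h4 =>
      (mem_comp.1 hw).2.2 y hy h3 (h4.trans hxw)⟩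
  · obtain ⟨d, hd, -, rfl⟩ := mem_ofEdges.1 hB
    obtain ⟨d', hd', -, rfl⟩ := mem_ofEdges.1 hB'
    rw [Function.onFun, Finset.disjoint_left]
    intro x hx hx'
    exact hne (congrArg _ (comp_eq_of_mem (by simpa using hd) (by simpa using hd') hx hx'))

theorem edgeSet_ofEdges {E : Finset t.V} (hE : E ⊆ Finset.univ \ minima Finset.univ) :
    edgeSet (ofEdges E) = E := by
  ext v
  rw [mem_edgeSet]
  constructor
  · rintro ⟨B, hB, hv, hl⟩
    obtain ⟨d, hd, h2, rfl⟩ := mem_ofEdges.1 hB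
    have hne : d ≠ v := by rintro rfl; exact hl (isLeast_comp (Finset.mem_univ _))
    rw [mem_comp] at hv
    exact hv.2.2 v hv.1 (lt_of_le_of_ne hv.2.1 hne) le_rfl
  · intro hv
    obtain ⟨d, hd, hvd⟩ := exists_mem_comp hE (Finset.mem_univ v)
    have hd' := (Finset.mem_sdiff.1 hd).2
    have hl := isLeast_comp (E := E) (Finset.mem_univ d)
    have hne : d ≠ v := by rintro rfl; exact hd' hv
    refine ⟨_, mem_ofEdges.2 ⟨d, hd', ?_, rfl⟩, hvd, fun h => hne (hl.unique h)⟩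
    exact Finset.one_lt_card.2 ⟨d, hl.1, v, hvd, hne⟩

/-- Disjointness prevents the root of one component from being a non-root vertex of another. -/
theorem notMem_edgeSet {s : Finset (Finset t.V)} (hs : t.IsSubforest s) {B : Finset t.V}
    (hB : B ∈ s) {r : t.V} (hr : IsLeast (B : Set t.V) r) : r ∉ edgeSet s := by
  intro h
  obtain ⟨B', hB', hrB', hl⟩ := mem_edgeSet.1 h
  have : B = B' := by
    by_contra hne
    exact Finset.disjoint_left.1 (hs.2 hB hB' hne) hr.1 hrB'
  exact hl (this ▸ hr)

theorem comp_edgeSet {s : Finset (Finset t.V)} (hs : t.IsSubforest s) {B : Finset t.V}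
    (hB : B ∈ s) {r : t.V} (hr : t.IsSubtree B r) : comp Finset.univ (edgeSet s) r = B := by
  ext x
  rw [mem_comp]
  constructor
  · rintro ⟨-, hrx, h⟩
    rcases hrx.eq_or_lt with rfl | hlt
    · exact hr.2.1.1
    · obtain ⟨B', hB', hx', hl'⟩ := mem_edgeSet.1 (h x (Finset.mem_univ _) hlt le_rfl)
      obtain ⟨r', hr'⟩ := hs.1 B' hB'
      have hr'x : r' ≤ x := hr'.2.1.2 hx'
      -- Otherwise r < r' ≤ x, so the root r' would be an edge of the subforest. Then r ∈ B' by
      -- connectedness, and disjointness forces B' = B.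
      have hle : r' ≤ r := by
        rcases t.chain r r' x hrx hr'x with h1 | h1
        · rcases h1.eq_or_lt with rfl | h1
          · exact le_rfl
          · exact absurd (h r' (Finset.mem_univ _) h1 hr'x) (notMem_edgeSet hs hB' hr'.2.1)
        · exact h1
      have hrB' : r ∈ B' := hr'.2.2 x hx' r hle hrx
      have : B = B' := by
        by_contra hne
        exact Finset.disjoint_left.1 (hs.2 hB hB' hne) hr.2.1.1 hrB'
      exact this ▸ hx'
  · intro hx
    refine ⟨Finset.mem_univ _, hr.2.1.2 hx, fun y _ hry hyx => ?_⟩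
    exact mem_edgeSet.2 ⟨B, hB, hr.2.2 x hx y hry.le hyx, fun h => hry.ne (hr.2.1.unique h)⟩

theorem ofEdges_edgeSet {s : Finset (Finset t.V)} (hs : t.IsSubforest s) :
    ofEdges (edgeSet s) = s := by
  ext B
  rw [mem_ofEdges]
  constructor
  · rintro ⟨d, hd, h2, rfl⟩
    obtain ⟨x, hx, hxd⟩ := Finset.exists_mem_ne h2 d
    have hx' := mem_comp.1 hx
    obtain ⟨B, hB, hxB, -⟩ := mem_edgeSet.1
      (hx'.2.2 x (Finset.mem_univ _) (lt_of_le_of_ne hx'.2.1 hxd.symm) le_rfl)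
    obtain ⟨r, hr⟩ := hs.1 B hB
    have hc := comp_edgeSet hs hB hr
    have : d = r := comp_eq_of_mem (by simpa using hd)
      (by simpa using notMem_edgeSet hs hB hr.2.1) hx (hc ▸ hxB)
    rw [this, hc]
    exact hB
  · intro hB
    obtain ⟨r, hr⟩ := hs.1 B hB
    have hc := comp_edgeSet hs hB hr
    exact ⟨r, notMem_edgeSet hs hB hr.2.1, hc.symm ▸ hr.1, hc⟩

theorem edgeSet_subset {s : Finset (Finset t.V)} :
    edgeSet s ⊆ Finset.univ \ minima Finset.univ := by
  intro v hv
  obtain ⟨B, hB, hvB, hl⟩ := mem_edgeSet.1 hv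
  rw [minima_of_isLeast isLeast_univ, Finset.mem_sdiff, Finset.mem_singleton]
  refine ⟨Finset.mem_univ _, ?_⟩
  rintro rfl
  exact hl ⟨hvB, fun w _ => t.root_le w⟩

theorem componentCls_eq (s : t.Subforest) (B : {B // B ∈ s.1}) :
    (X (s.componentCls B) : H K) = compVar K B.1 := by
  have h : (s.componentCls B).1 = sub B.1 := cls_restrict _ _ rfl _ _
  have h1 : 1 ≤ (sub B.1).edges := h ▸ (s.componentCls B).2
  rw [compVar, dif_pos h1]
  exact congrArg X (Subtype.ext h)

theorem compVar_of_card_lt {B : Finset t.V} (hB : ∃ r, IsLeast (B : Set t.V) r) (h : B.card < 2) :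
    compVar K B = 1 := by
  rw [compVar, dif_neg]
  rw [RTree.edges, vertices_sub B hB]
  omega

/-- The factors of `components` missing on the left belong to one-vertex components, and these equal
1. -/
theorem prod_componentCls (s : t.Subforest) :
    ∏ B ∈ s.1.attach, (X (s.componentCls B) : H K) =
      components K Finset.univ (edgeSet s.1) := by
  rw [Finset.prod_congr rfl (fun B _ => componentCls_eq K s B),
    Finset.prod_attach s.1 (compVar K)]
  conv_lhs => rw [← ofEdges_edgeSet s.2]
  rw [ofEdges, Finset.prod_image, components, Finset.prod_filter]
  · refine Finset.prod_congr rfl fun d _ => ?_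
    split_ifs with h
    · rfl
    · exact (compVar_of_card_lt K ⟨d, isLeast_comp (Finset.mem_univ _)⟩ (not_le.1 h)).symm
  · intro d _ d' _ h
    have h' : comp Finset.univ (edgeSet s.1) d = comp Finset.univ (edgeSet s.1) d' := h
    exact (isLeast_comp (Finset.mem_univ d)).unique (h' ▸ isLeast_comp (Finset.mem_univ d'))

theorem cls_contract (s : t.Subforest) :
    s.contract.cls = sub (Finset.univ \ edgeSet s.1) := by
  refine cls_restrict _ _ ?_ _ _
  ext v
  simp [mem_edgeSet]

theorem root_notMem_of_subset {E : Finset t.V} (hE : E ⊆ Finset.univ \ minima Finset.univ) :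
    t.root ∉ E := by
  intro h
  have := hE h
  rw [minima_of_isLeast isLeast_univ] at this
  simp at this

theorem coactSum_univ : coactSum K (Finset.univ : Finset t.V) = ∑ s : t.Subforest,
    (∏ B ∈ s.1.attach, (X (s.componentCls B) : H K)) ⊗ₜ[K] (X s.contract.cls : HCK K) := by
  rw [coactSum]
  symm
  refine Finset.sum_bij' (fun s _ => edgeSet s.1)
    (fun E _ => ⟨ofEdges E, isSubforest_ofEdges E⟩) ?_ ?_ ?_ ?_ ?_
  · intro s _
    exact Finset.mem_powerset.2 edgeSet_subset
  · intro E _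
    exact Finset.mem_univ _
  · intro s _
    exact Subtype.ext (ofEdges_edgeSet s.2)
  · intro E hE
    exact edgeSet_ofEdges (Finset.mem_powerset.1 hE)
  · intro s _
    rw [prod_componentCls, cls_contract,
      forest_of_isLeast K (isLeast_compl_root (root_notMem_of_subset edgeSet_subset))]

theorem treeCoaction_sub (S : Finset t.V) (hS : ∃ r, IsLeast (S : Set t.V) r) :
    treeCoaction K (sub S) = coactSum K S := by
  obtain ⟨f, hf⟩ := exists_embedding_rep S hS
  conv_rhs => rw [← hf]
  rw [coactSum_map, coactSum_univ, treeCoaction]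

/-! ### The coaction on a forest of vertices -/

theorem sdiff_minima_eq_biUnion (S : Finset t.V) :
    S \ minima S = (minima S).biUnion fun c => above S c \ minima (above S c) := by
  ext x
  rw [Finset.mem_biUnion]
  constructor
  · intro hx
    obtain ⟨hxS, hxm⟩ := Finset.mem_sdiff.1 hx
    obtain ⟨c, hc, hcx⟩ := exists_minima_le hxS
    refine ⟨c, hc, Finset.mem_sdiff.2 ⟨mem_above.2 ⟨hxS, hcx⟩, ?_⟩⟩
    rw [minima_of_isLeast (isLeast_above (minima_subset _ hc)), Finset.mem_singleton]
    rintro rfl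
    exact hxm hc
  · rintro ⟨c, hc, hx⟩
    rw [minima_of_isLeast (isLeast_above (minima_subset _ hc)), Finset.mem_sdiff, mem_above,
      Finset.mem_singleton] at hx
    refine Finset.mem_sdiff.2 ⟨hx.1.1, fun hm => hx.2 ?_⟩
    exact ((mem_minima.1 hm).2 c (minima_subset _ hc) hx.1.2).symm

/-- Contraction keeps the roots, so a contracted forest has the same number of trees; this lets the
coaction be expanded tree by tree. -/
theorem minima_sdiff {S E : Finset t.V} (hE : E ⊆ S \ minima S) : minima (S \ E) = minima S := by
  ext c
  constructor
  · intro hc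
    have hcS := (Finset.mem_sdiff.1 (minima_subset _ hc))
    obtain ⟨d, hd, hdc⟩ := exists_minima_le hcS.1
    have : d = c := (mem_minima.1 hc).2 d (Finset.mem_sdiff.2 ⟨minima_subset _ hd, fun h =>
      (Finset.mem_sdiff.1 (hE h)).2 hd⟩) hdc
    exact this ▸ hd
  · intro hc
    exact mem_minima.2 ⟨Finset.mem_sdiff.2 ⟨minima_subset _ hc, fun h =>
      (Finset.mem_sdiff.1 (hE h)).2 hc⟩, fun x hx =>
      (mem_minima.1 hc).2 x (Finset.mem_sdiff.1 hx).1⟩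

theorem isLeast_above_sdiff {S E : Finset t.V} {c : t.V} (hc : c ∈ minima S) :
    IsLeast ((above S c \ (E ∩ (above S c \ minima (above S c))) : Finset t.V) : Set t.V) c := by
  have h := isLeast_above (minima_subset _ hc)
  refine ⟨?_, fun x hx => h.2 (Finset.mem_sdiff.1 hx).1⟩
  rw [minima_of_isLeast h]
  exact Finset.mem_sdiff.2 ⟨h.1, by simp⟩

theorem forest_sdiff {S E : Finset t.V} (hE : E ⊆ S \ minima S) :
    forest K (S \ E) = ∏ c ∈ minima S,
      forest K (above S c \ (E ∩ (above S c \ minima (above S c)))) := by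
  rw [forest, minima_sdiff hE]
  refine Finset.prod_congr rfl fun c hc => ?_
  rw [forest_of_isLeast K (isLeast_above_sdiff hc),
    minima_of_isLeast (isLeast_above (minima_subset _ hc))]
  congr 2
  ext x
  have : x ∈ E → x ≠ c := by rintro h rfl; exact (Finset.mem_sdiff.1 (hE h)).2 hc
  simp only [mem_above, Finset.mem_sdiff, Finset.mem_inter, Finset.mem_singleton]
  tauto

/-- The component of d lies above d, hence in the tree of the forest S that contains d. -/
theorem components_eq_prod {S E : Finset t.V} (hE : E ⊆ S \ minima S) :
    components K S E = ∏ c ∈ minima S,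
      components K (above S c) (E ∩ (above S c \ minima (above S c))) := by
  have hu : S \ E = (minima S).biUnion fun c =>
      above S c \ (E ∩ (above S c \ minima (above S c))) := by
    ext x
    rw [Finset.mem_biUnion]
    constructor
    · intro hx
      obtain ⟨hxS, hxE⟩ := Finset.mem_sdiff.1 hx
      obtain ⟨c, hc, hcx⟩ := exists_minima_le hxS
      exact ⟨c, hc, Finset.mem_sdiff.2 ⟨mem_above.2 ⟨hxS, hcx⟩,
        fun h => hxE (Finset.mem_inter.1 h).1⟩⟩
    · rintro ⟨c, hc, hx⟩
      rw [minima_of_isLeast (isLeast_above (minima_subset _ hc))] at hx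
      have : x ∈ E → x ≠ c := by rintro h rfl; exact (Finset.mem_sdiff.1 (hE h)).2 hc
      simp only [mem_above, Finset.mem_sdiff, Finset.mem_inter, Finset.mem_singleton] at hx ⊢
      tauto
  rw [components, hu, Finset.prod_biUnion]
  · refine Finset.prod_congr rfl fun c hc => Finset.prod_congr rfl fun d hd => congrArg _ ?_
    have hcd := (mem_above.1 (Finset.mem_sdiff.1 hd).1).2
    rw [minima_of_isLeast (isLeast_above (minima_subset _ hc))]
    ext x
    simp only [mem_comp, mem_above, Finset.mem_inter, Finset.mem_sdiff, Finset.mem_singleton]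
    constructor
    · rintro ⟨hx, hdx, h⟩
      exact ⟨⟨hx, hcd.trans hdx⟩, hdx, fun y hy h1 h2 =>
        ⟨h y hy.1 h1 h2, hy, (hcd.trans_lt h1).ne'⟩⟩
    · rintro ⟨⟨hx, -⟩, hdx, h⟩
      exact ⟨hx, hdx, fun y hy h1 h2 => (h y ⟨hy, hcd.trans h1.le⟩ h1 h2).1⟩
  · intro c hc c' hc' hne
    exact (above_minima_disjoint hc hc' hne).mono Finset.sdiff_subset Finset.sdiff_subset

theorem prod_tmul_prod {A B ι : Type*} [CommRing A] [CommRing B] [Algebra K A] [Algebra K B]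
    (C : Finset ι) (f : ι → A) (g : ι → B) :
    ∏ c ∈ C, (f c ⊗ₜ[K] g c) = (∏ c ∈ C, f c) ⊗ₜ[K] (∏ c ∈ C, g c) := by
  induction C using Finset.induction_on with
  | empty => simp [Algebra.TensorProduct.one_def]
  | insert c C hc ih =>
    rw [Finset.prod_insert hc, Finset.prod_insert hc, Finset.prod_insert hc, ih,
      Algebra.TensorProduct.tmul_mul_tmul]

/-- Φ is multiplicative, and a set of edges of a forest is a choice of one in each tree. The formula
is needed because the pruned part of a cut is a forest. -/
theorem coaction_forest (S : Finset t.V) : coaction K (forest K S) = coactSum K S := by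
  have h : ∀ c ∈ minima S, coaction K (X (sub (above S c))) = coactSum K (above S c) := by
    intro c hc
    rw [coaction, aeval_X, treeCoaction_sub K _ ⟨c, isLeast_above (minima_subset _ hc)⟩]
  rw [forest, map_prod, Finset.prod_congr rfl h]
  simp only [coactSum]
  rw [prod_sum_powerset (minima S) (fun c => above S c \ minima (above S c))
    (above_minima_disjoint.mono fun c => Finset.sdiff_subset)
    (fun c E => components K (above S c) E ⊗ₜ forest K (above S c \ E)),
    ← sdiff_minima_eq_biUnion]
  refine Finset.sum_congr rfl fun E hE => ?_
  rw [Finset.mem_powerset] at hE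
  rw [prod_tmul_prod, ← components_eq_prod K hE, ← forest_sdiff K hE]

end FinTree

/-! ### Compatibility of the coaction with the coproduct -/

section

variable (K : Type*) [Field K]

/-- The map `(h₁ ⊗ x) ⊗ (h₂ ⊗ y) ↦ h₁ h₂ ⊗ (x ⊗ y)`. -/
def mulLeft : (H K ⊗[K] HCK K) ⊗[K] (H K ⊗[K] HCK K) →ₐ[K] H K ⊗[K] (HCK K ⊗[K] HCK K) :=
  (Algebra.TensorProduct.map (Algebra.TensorProduct.lmul' K) (AlgHom.id K _)).comp
    (Algebra.TensorProduct.tensorTensorTensorComm K K K K (H K) (HCK K) (H K) (HCK K)).toAlgHom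

theorem mulLeft_tmul (h₁ h₂ : H K) (x y : HCK K) :
    mulLeft K ((h₁ ⊗ₜ x) ⊗ₜ (h₂ ⊗ₜ y)) = (h₁ * h₂) ⊗ₜ (x ⊗ₜ y) := by
  simp [mulLeft]

/-- Both sides are algebra morphisms, so trees suffice; there the two expansions match term by term
through `sum_contract_cut` and `components_mul`. -/
theorem coaction_deltaCK :
    (Algebra.TensorProduct.map (AlgHom.id K (H K)) (deltaCK K)).comp (coaction K) =
      ((mulLeft K).comp (Algebra.TensorProduct.map (coaction K) (coaction K))).comp
        (deltaCK K) := by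
  refine MvPolynomial.algHom_ext fun T => ?_
  have hT : FinTree.sub (Finset.univ : Finset T.rep.V) = T := by
    rw [FinTree.sub_univ, FinTree.cls_rep]
  have hl := FinTree.isLeast_univ (t := T.rep)
  have h1 : coaction K (X T) = FinTree.coactSum K (Finset.univ : Finset T.rep.V) := by
    rw [← FinTree.coaction_forest, FinTree.forest_of_isLeast K hl, hT]
  have h2 : deltaCK K (X T) = FinTree.coprodSum K (Finset.univ : Finset T.rep.V) := by
    rw [deltaCK, aeval_X, ← FinTree.treeCoproduct_sub K _ ⟨_, hl⟩, hT]
  rw [AlgHom.comp_apply, AlgHom.comp_apply, AlgHom.comp_apply, h1, h2, FinTree.coactSum,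
    FinTree.coprodSum, map_sum, map_sum, map_sum]
  have h3 : ∀ E ∈ ((Finset.univ : Finset T.rep.V) \ FinTree.minima Finset.univ).powerset,
      Algebra.TensorProduct.map (AlgHom.id K (H K)) (deltaCK K)
        (FinTree.components K Finset.univ E ⊗ₜ FinTree.forest K (Finset.univ \ E)) =
      ∑ U ∈ FinTree.uppers (Finset.univ \ E), FinTree.components K Finset.univ E ⊗ₜ[K]
        (FinTree.forest K U ⊗ₜ[K] FinTree.forest K ((Finset.univ \ E) \ U)) := by
    intro E hE
    -- The root survives contraction, so the quotient is a single tree and the tree formula for Δ_CK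
    -- applies to it.
    have hl' := FinTree.isLeast_compl_root
      (FinTree.root_notMem_of_subset (Finset.mem_powerset.1 hE))
    rw [Algebra.TensorProduct.map_tmul, FinTree.forest_of_isLeast K hl', deltaCK, aeval_X,
      FinTree.treeCoproduct_sub K _ ⟨_, hl'⟩, FinTree.coprodSum, TensorProduct.tmul_sum]
    rfl
  rw [Finset.sum_congr rfl h3, FinTree.sum_contract_cut Finset.univ
    (fun E U R => FinTree.components K Finset.univ E ⊗ₜ[K]
        (FinTree.forest K U ⊗ₜ[K] FinTree.forest K R))]
  refine Finset.sum_congr rfl fun W hW => ?_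
  rw [Algebra.TensorProduct.map_tmul, FinTree.coaction_forest, FinTree.coaction_forest,
    FinTree.coactSum, FinTree.coactSum, TensorProduct.sum_tmul, map_sum]
  refine Finset.sum_congr rfl fun E₁ h₁ => ?_
  rw [TensorProduct.tmul_sum, map_sum]
  refine Finset.sum_congr rfl fun E₂ h₂ => ?_
  rw [mulLeft_tmul, FinTree.components_mul K hW (Finset.mem_powerset.1 h₁)
    (Finset.mem_powerset.1 h₂)]

end

/-! ### Gradings -/

section Grading

variable (K : Type*) [Field K] {ρ σ τ : Type*}

/-- The homogeneous part of degree `n` of the tensor product of two weighted polynomial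
algebras. -/
def tensorGraded (w : σ → ℕ) (w' : τ → ℕ) (n : ℕ) :
    Submodule K (MvPolynomial σ K ⊗[K] MvPolynomial τ K) :=
  Submodule.span K {z | ∃ i j x y, i + j = n ∧ IsWeightedHomogeneous w x i ∧
    IsWeightedHomogeneous w' y j ∧ z = x ⊗ₜ[K] y}

variable {K} {w : σ → ℕ} {w' : τ → ℕ}

theorem tmul_mem_tensorGraded {i j n : ℕ} {x : MvPolynomial σ K} {y : MvPolynomial τ K}
    (hx : IsWeightedHomogeneous w x i) (hy : IsWeightedHomogeneous w' y j) (h : i + j = n) :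
    x ⊗ₜ[K] y ∈ tensorGraded K w w' n :=
  Submodule.subset_span ⟨i, j, x, y, h, hx, hy, rfl⟩

theorem one_mem_tensorGraded : (1 : MvPolynomial σ K ⊗[K] MvPolynomial τ K) ∈
    tensorGraded K w w' 0 :=
  tmul_mem_tensorGraded (isWeightedHomogeneous_one K w) (isWeightedHomogeneous_one K w') rfl

theorem mul_mem_tensorGraded {m n : ℕ} {u v : MvPolynomial σ K ⊗[K] MvPolynomial τ K}
    (hu : u ∈ tensorGraded K w w' m) (hv : v ∈ tensorGraded K w w' n) :
    u * v ∈ tensorGraded K w w' (m + n) := by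
  induction hu using Submodule.span_induction with
  | zero => simp
  | add x y _ _ hx hy => rw [add_mul]; exact Submodule.add_mem _ hx hy
  | smul c x _ hx => rw [smul_mul_assoc]; exact Submodule.smul_mem _ _ hx
  | mem u hu =>
    obtain ⟨i, j, x, y, rfl, hx, hy, rfl⟩ := hu
    induction hv using Submodule.span_induction with
    | zero => simp
    | add x y _ _ hx hy => rw [mul_add]; exact Submodule.add_mem _ hx hy
    | smul c x _ hx => rw [mul_smul_comm]; exact Submodule.smul_mem _ _ hx
    | mem v hv =>
      obtain ⟨i', j', x', y', rfl, hx', hy', rfl⟩ := hv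
      rw [Algebra.TensorProduct.tmul_mul_tmul]
      exact tmul_mem_tensorGraded (hx.mul hx') (hy.mul hy') (by omega)

theorem pow_mem_tensorGraded {m : ℕ} {u : MvPolynomial σ K ⊗[K] MvPolynomial τ K}
    (hu : u ∈ tensorGraded K w w' m) (k : ℕ) : u ^ k ∈ tensorGraded K w w' (k * m) := by
  induction k with
  | zero => simpa using one_mem_tensorGraded
  | succ k ih => rw [pow_succ, Nat.succ_mul]; exact mul_mem_tensorGraded ih hu

theorem aeval_mem_tensorGraded {v : ρ → ℕ} (f : ρ → MvPolynomial σ K ⊗[K] MvPolynomial τ K)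
    (hf : ∀ i, f i ∈ tensorGraded K w w' (v i)) {n : ℕ} {x : MvPolynomial ρ K}
    (hx : IsWeightedHomogeneous v x n) : aeval f x ∈ tensorGraded K w w' n := by
  rw [x.as_sum, map_sum]
  refine Submodule.sum_mem _ fun m hm => ?_
  rw [aeval_monomial, ← Algebra.smul_def]
  refine Submodule.smul_mem _ _ ?_
  -- The degree becomes the weight of m itself, which frees m for induction.
  rw [← hx (mem_support_iff.1 hm)]
  clear hx hm
  induction m using Finsupp.induction with
  | zero => simpa using one_mem_tensorGraded
  | single_add i k m hi hk ih =>
    rw [Finsupp.prod_add_index' (by simp) (by intros; rw [pow_add]),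
      Finsupp.prod_single_index (by simp), map_add, Finsupp.weight_single, smul_eq_mul]
    exact mul_mem_tensorGraded (pow_mem_tensorGraded (hf i) k) ih

theorem dualDistrib_comp_aeval_mem_gradedDual {v : ρ → ℕ}
    (f : ρ → MvPolynomial σ K ⊗[K] MvPolynomial τ K)
    (hf : ∀ i, f i ∈ tensorGraded K w w' (v i)) (α : gradedDual K w) (β : gradedDual K w') :
    (TensorProduct.dualDistrib K _ _ (α.1 ⊗ₜ β.1)) ∘ₗ (aeval f).toLinearMap ∈ gradedDual K v := by
  obtain ⟨M, hM⟩ := α.2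
  obtain ⟨N, hN⟩ := β.2
  refine ⟨M + N, fun n hn x hx => ?_⟩
  have h := aeval_mem_tensorGraded f hf ((mem_weightedHomogeneousSubmodule _ _ _ _).1 hx)
  change TensorProduct.dualDistrib K _ _ (α.1 ⊗ₜ β.1) (aeval f x) = 0
  generalize aeval f x = z at h
  induction h using Submodule.span_induction with
  | zero => simp
  | add x y _ _ hx hy => rw [map_add, hx, hy, add_zero]
  | smul c x _ hx => rw [map_smul, hx, smul_zero]
  | mem u hu =>
    obtain ⟨i, j, x, y, hij, hx, hy, rfl⟩ := hu
    rw [TensorProduct.dualDistrib_apply]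
    -- As i + j ≥ M + N, either i ≥ M or j ≥ N, and one factor vanishes.
    rcases le_or_gt M i with h | h
    · rw [hM i h x hx, zero_mul]
    · rw [hN j (by omega) y hy, mul_zero]

end Grading

/-! ### Degrees of forests and components -/

namespace FinTree

variable {t : FinTree} (K : Type*) [Field K]

theorem sum_card_above (S : Finset t.V) : ∑ c ∈ minima S, (above S c).card = S.card := by
  rw [← Finset.card_biUnion (fun c hc c' hc' h => above_minima_disjoint hc hc' h)]
  congr 1
  ext x
  rw [Finset.mem_biUnion]
  constructor
  · rintro ⟨c, -, h⟩
    exact (mem_above.1 h).1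
  · intro hx
    obtain ⟨c, hc, hcx⟩ := exists_minima_le hx
    exact ⟨c, hc, mem_above.2 ⟨hx, hcx⟩⟩

theorem isWeightedHomogeneous_forest (S : Finset t.V) :
    IsWeightedHomogeneous RTree.vertices (forest K S) S.card := by
  rw [← sum_card_above S]
  refine IsWeightedHomogeneous.prod _ _ _ fun c hc => ?_
  rw [← vertices_sub _ ⟨c, isLeast_above (minima_subset _ hc)⟩]
  exact isWeightedHomogeneous_X _ _ _

theorem sum_card_comp {S E : Finset t.V} (hE : E ⊆ S \ minima S) :
    ∑ d ∈ S \ E, (comp S E d).card = S.card := by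
  rw [← Finset.card_biUnion (fun d hd d' hd' h => Finset.disjoint_left.2 fun x hx hx' =>
    h (comp_eq_of_mem hd hd' hx hx'))]
  congr 1
  ext x
  rw [Finset.mem_biUnion]
  constructor
  · rintro ⟨c, -, h⟩
    exact (mem_comp.1 h).1
  · exact exists_mem_comp hE

theorem isWeightedHomogeneous_compVar {B : Finset t.V} (hB : ∃ r, IsLeast (B : Set t.V) r) :
    IsWeightedHomogeneous (fun T : RTree' => T.1.edges) (compVar K B) (B.card - 1) := by
  have h : B.card - 1 = (sub B).edges := by rw [RTree.edges, vertices_sub B hB]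
  rw [compVar, h]
  split_ifs with h1
  · exact isWeightedHomogeneous_X K (fun T : RTree' => T.1.edges) ⟨sub B, h1⟩
  · rw [Nat.lt_one_iff.1 (not_le.1 h1)]
    exact isWeightedHomogeneous_one _ _

/-- The components partition S and are |S \ E| in number; each has one edge fewer than vertices, so
the edges total |S| - |S \ E| = |E|. -/
theorem isWeightedHomogeneous_components {S E : Finset t.V} (hE : E ⊆ S \ minima S) :
    IsWeightedHomogeneous (fun T : RTree' => T.1.edges) (components K S E) E.card := by
  have h : ∑ d ∈ S \ E, ((comp S E d).card - 1) = E.card := by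
    have h1 : ∑ d ∈ S \ E, ((comp S E d).card - 1) + ∑ d ∈ S \ E, 1 = S.card := by
      rw [← Finset.sum_add_distrib, ← sum_card_comp hE]
      refine Finset.sum_congr rfl fun d hd => ?_
      have := Finset.card_pos.2 ⟨d, (isLeast_comp (E := E) (Finset.mem_sdiff.1 hd).1).1⟩
      omega
    rw [← Finset.card_eq_sum_ones] at h1
    have := Finset.card_sdiff_add_card_eq_card (hE.trans Finset.sdiff_subset)
    omega
  rw [← h]
  exact IsWeightedHomogeneous.prod _ _ _ fun d hd =>
    isWeightedHomogeneous_compVar K ⟨d, isLeast_comp (Finset.mem_sdiff.1 hd).1⟩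

end FinTree

variable (K : Type*) [Field K]

theorem treeCoproduct_eq (T : RTree) :
    treeCoproduct K T = FinTree.coprodSum K (Finset.univ : Finset T.rep.V) := by
  rw [← FinTree.treeCoproduct_sub K _ ⟨_, FinTree.isLeast_univ⟩, FinTree.sub_univ,
    FinTree.cls_rep]

theorem treeCoaction_eq (T : RTree) :
    treeCoaction K T = FinTree.coactSum K (Finset.univ : Finset T.rep.V) := by
  rw [← FinTree.treeCoaction_sub K _ ⟨_, FinTree.isLeast_univ⟩, FinTree.sub_univ,
    FinTree.cls_rep]

theorem card_rep (T : RTree) : (Finset.univ : Finset T.rep.V).card = T.vertices := by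
  rw [← FinTree.vertices_sub _ ⟨_, FinTree.isLeast_univ⟩, FinTree.sub_univ, FinTree.cls_rep]

theorem treeCoproduct_mem (T : RTree) : treeCoproduct K T ∈
    tensorGraded K RTree.vertices RTree.vertices T.vertices := by
  rw [treeCoproduct_eq, ← card_rep]
  refine Submodule.sum_mem _ fun W hW => tmul_mem_tensorGraded
    (FinTree.isWeightedHomogeneous_forest K _) (FinTree.isWeightedHomogeneous_forest K _) ?_
  rw [add_comm]
  exact Finset.card_sdiff_add_card_eq_card (FinTree.mem_uppers.1 hW).1

theorem treeCoaction_mem (T : RTree) : treeCoaction K T ∈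
    tensorGraded K (fun T : RTree' => T.1.edges) RTree.vertices T.vertices := by
  rw [treeCoaction_eq, ← card_rep]
  refine Submodule.sum_mem _ fun E hE => tmul_mem_tensorGraded
    (FinTree.isWeightedHomogeneous_components K (Finset.mem_powerset.1 hE))
    (FinTree.isWeightedHomogeneous_forest K _) ?_
  rw [add_comm]
  exact Finset.card_sdiff_add_card_eq_card
    ((Finset.mem_powerset.1 hE).trans Finset.sdiff_subset)

theorem conv_mem (a b : HCK0 K) : conv K a b ∈ HCK0 K :=
  dualDistrib_comp_aeval_mem_gradedDual _ (treeCoproduct_mem K) a b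

theorem act_mem (α : H0 K) (a : HCK0 K) : act K α a ∈ HCK0 K :=
  dualDistrib_comp_aeval_mem_gradedDual _ (treeCoaction_mem K) α a

/-! ### Duality -/

variable {K} (a b : Module.Dual K (HCK K))

/-- The linear form `(h₁ ⊗ x) ⊗ (h₂ ⊗ y) ↦ β(h₁ ⊗ h₂) a(x) b(y)`, linearly in `β`. -/
def pairing : Module.Dual K (H K ⊗[K] H K) →ₗ[K]
    Module.Dual K ((H K ⊗[K] HCK K) ⊗[K] (H K ⊗[K] HCK K)) :=
  (TensorProduct.tensorTensorTensorComm K (H K) (HCK K) (H K) (HCK K)).toLinearMap.dualMap ∘ₗ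
    (TensorProduct.curry (TensorProduct.dualDistrib K (H K ⊗[K] H K) (HCK K ⊗[K] HCK K))).flip
      (TensorProduct.dualDistrib K (HCK K) (HCK K) (a ⊗ₜ b))

theorem pairing_tmul (β : Module.Dual K (H K ⊗[K] H K)) (h₁ h₂ : H K) (x y : HCK K) :
    pairing a b β ((h₁ ⊗ₜ x) ⊗ₜ (h₂ ⊗ₜ y)) = β (h₁ ⊗ₜ h₂) * (a x * b y) := rfl

theorem conv_act_act (α₁ α₂ : Module.Dual K (H K)) (x : HCK K) :
    conv K (act K α₁ a) (act K α₂ b) x =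
      pairing a b (TensorProduct.dualDistrib K _ _ (α₁ ⊗ₜ α₂))
        (Algebra.TensorProduct.map (coaction K) (coaction K) (deltaCK K x)) := by
  rw [conv_apply]
  have h : ∀ u v : H K ⊗[K] HCK K,
      TensorProduct.dualDistrib K _ _ (α₁ ⊗ₜ a) u * TensorProduct.dualDistrib K _ _ (α₂ ⊗ₜ b) v =
        pairing a b (TensorProduct.dualDistrib K _ _ (α₁ ⊗ₜ α₂)) (u ⊗ₜ v) := by
    intro u v
    induction u using TensorProduct.induction_on with
    | zero => simp
    | add u u' hu hu' => rw [map_add, add_mul, hu, hu', TensorProduct.add_tmul, map_add]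
    | tmul h₁ x =>
      induction v using TensorProduct.induction_on with
      | zero => simp
      | add u u' hu hu' => rw [map_add, mul_add, hu, hu', TensorProduct.tmul_add, map_add]
      | tmul h₂ y =>
        rw [pairing_tmul, TensorProduct.dualDistrib_apply, TensorProduct.dualDistrib_apply,
          TensorProduct.dualDistrib_apply]
        ring
  generalize deltaCK K x = z
  induction z using TensorProduct.induction_on with
  | zero => simp
  | add u u' hu hu' => rw [map_add, hu, hu', map_add, map_add]
  | tmul u v =>
    rw [TensorProduct.dualDistrib_apply, act_apply, act_apply, h, Algebra.TensorProduct.map_tmul]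

/-- Any β dual to multiplication against α is allowed, so the lemma serves both for the coproduct of
α and for α ⊗ ε + ε ⊗ α. -/
theorem act_conv (α : Module.Dual K (H K)) (β : Module.Dual K (H K ⊗[K] H K))
    (hβ : ∀ x y, β (x ⊗ₜ y) = α (x * y)) (x : HCK K) :
    act K α (conv K a b) x = pairing a b β
      (Algebra.TensorProduct.map (coaction K) (coaction K) (deltaCK K x)) := by
  have h1 : ∀ z : H K ⊗[K] HCK K, TensorProduct.dualDistrib K _ _ (α ⊗ₜ conv K a b) z =
      TensorProduct.dualDistrib K _ _ (α ⊗ₜ TensorProduct.dualDistrib K _ _ (a ⊗ₜ b))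
        (Algebra.TensorProduct.map (AlgHom.id K (H K)) (deltaCK K) z) := by
    intro z
    induction z using TensorProduct.induction_on with
    | zero => simp
    | add u u' hu hu' => rw [map_add, hu, hu', map_add, map_add]
    | tmul h x => rfl
  have h2 : ∀ z, TensorProduct.dualDistrib K _ _ (α ⊗ₜ TensorProduct.dualDistrib K _ _ (a ⊗ₜ b))
      (mulLeft K z) = pairing a b β z := by
    intro z
    induction z using TensorProduct.induction_on with
    | zero => simp
    | add u u' hu hu' => rw [map_add, map_add, hu, hu', map_add]
    | tmul u v =>
      induction u using TensorProduct.induction_on with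
      | zero => simp
      | add u u' hu hu' => rw [TensorProduct.add_tmul, map_add, map_add, hu, hu', map_add]
      | tmul h₁ x =>
        induction v using TensorProduct.induction_on with
        | zero => simp
        | add u u' hu hu' => rw [TensorProduct.tmul_add, map_add, map_add, hu, hu', map_add]
        | tmul h₂ y =>
          rw [pairing_tmul, mulLeft_tmul, hβ]
          rfl
  rw [act_apply, h1, ← h2]
  exact congrArg _ (DFunLike.congr_fun (coaction_deltaCK K) x)

theorem actConvAct_apply (c : H0 K ⊗[K] H0 K) (x : HCK K) :
    actConvAct K a b c x = pairing a b (TensorProduct.dualDistrib K _ _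
      (TensorProduct.map (H0 K).subtype (H0 K).subtype c))
        (Algebra.TensorProduct.map (coaction K) (coaction K) (deltaCK K x)) := by
  induction c using TensorProduct.induction_on with
  | zero => simp
  | add u u' hu hu' => simp only [map_add, LinearMap.add_apply, hu, hu']
  | tmul α₁ α₂ =>
    rw [actConvAct_tmul, conv_act_act]
    rfl

theorem actConvAct_comul (α : H0 K) :
    actConvAct K a b (comul K α) = act K α (conv K a b) := by
  refine LinearMap.ext fun x => ?_
  rw [actConvAct_apply, act_conv a b α.1 _ (dualDistrib_comul K α)]

/-! ### The counit and infinitesimal characters -/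

/-- The counit of `H`, which takes the constant coefficient. -/
def counit : H K →ₐ[K] K := aeval 0

theorem counit_apply (x : H K) : counit x = constantCoeff x := by
  rw [counit, aeval_zero]
  rfl

/-- A non-empty subforest contributes a variable, which ε kills; only the empty one remains, and its
contraction is the tree itself. -/
theorem counit_coaction :
    (Algebra.TensorProduct.lid K (HCK K)).toAlgHom.comp
      ((Algebra.TensorProduct.map counit (AlgHom.id K (HCK K))).comp (coaction K)) =
      AlgHom.id K (HCK K) := by
  refine MvPolynomial.algHom_ext fun T => ?_
  obtain ⟨s₀, hs₀⟩ : ∃ s : T.rep.Subforest, s.1 = ∅ := ⟨⟨∅, by simp, by simp⟩, rfl⟩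
  rw [AlgHom.comp_apply, AlgHom.comp_apply, coaction, aeval_X, treeCoaction, map_sum, map_sum]
  refine Eq.trans (Finset.sum_eq_single s₀ (fun (s : T.rep.Subforest) _ hs => ?_) ?_) ?_
  · have hne : s.1.Nonempty := by
      by_contra h
      exact hs (Subtype.ext ((Finset.not_nonempty_iff_eq_empty.1 h).trans hs₀.symm))
    obtain ⟨B, hB⟩ := hne
    have : counit (∏ B ∈ s.1.attach, (X (s.componentCls B) : H K)) = 0 := by
      rw [map_prod]
      exact Finset.prod_eq_zero (Finset.mem_attach _ ⟨B, hB⟩) (by simp [counit])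
    rw [Algebra.TensorProduct.map_tmul, this, TensorProduct.zero_tmul, map_zero]
  · intro h
    exact absurd (Finset.mem_univ _) h
  · have hE : FinTree.edgeSet s₀.1 = ∅ := by rw [hs₀]; simp [FinTree.edgeSet]
    rw [FinTree.prod_componentCls, FinTree.cls_contract, hE, Finset.sdiff_empty,
      FinTree.sub_univ, FinTree.cls_rep]
    have hc : FinTree.components K (Finset.univ : Finset T.rep.V) ∅ = 1 := by
      rw [← hE, ← FinTree.prod_componentCls]
      exact Finset.prod_eq_one fun B _ => absurd B.2 (by simp [hs₀])
    rw [hc]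
    simp

theorem act_counit : act K (counit (K := K)).toLinearMap a = a := by
  refine LinearMap.ext fun x => ?_
  have h : ∀ z : H K ⊗[K] HCK K,
      TensorProduct.dualDistrib K _ _ ((counit (K := K)).toLinearMap ⊗ₜ a) z =
      a (Algebra.TensorProduct.lid K (HCK K)
        (Algebra.TensorProduct.map counit (AlgHom.id K (HCK K)) z)) := by
    intro z
    induction z using TensorProduct.induction_on with
    | zero => simp
    | add u u' hu hu' => rw [map_add, hu, hu', map_add, map_add, map_add]
    | tmul h x => simp
  rw [act_apply, h]
  exact congrArg a (DFunLike.congr_fun counit_coaction x)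

theorem act_conv_of_isInfinitesimalCharacter (α : Module.Dual K (H K))
    (hα : IsInfinitesimalCharacter K α) :
    act K α (conv K a b) = conv K (act K α a) b + conv K a (act K α b) := by
  refine LinearMap.ext fun x => ?_
  have h1 := conv_act_act a b α (counit (K := K)).toLinearMap x
  have h2 := conv_act_act a b (counit (K := K)).toLinearMap α x
  rw [act_counit] at h1 h2
  rw [LinearMap.add_apply, h1, h2, ← LinearMap.add_apply, ← map_add, ← map_add]
  -- Here β = α ⊗ ε + ε ⊗ α, and the condition on β is exactly the definition of an infinitesimal
  -- character.
  refine act_conv a b α _ (fun x y => ?_) x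
  rw [hα, map_add, LinearMap.add_apply, TensorProduct.dualDistrib_apply,
    TensorProduct.dualDistrib_apply, AlgHom.toLinearMap_apply, AlgHom.toLinearMap_apply,
    counit_apply, counit_apply]

end TreeHopf

end

theorem mainTheorem2 (K : Type*) [Field K] (α : TreeHopf.H0 K) (a b : TreeHopf.HCK0 K) :
    TreeHopf.act K α a ∈ TreeHopf.HCK0 K ∧
    TreeHopf.conv K a b ∈ TreeHopf.HCK0 K ∧
    TreeHopf.actConvAct K a b (TreeHopf.comul K α) =
      TreeHopf.act K α (TreeHopf.conv K a b) ∧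
    (TreeHopf.IsInfinitesimalCharacter K α →
      TreeHopf.act K α (TreeHopf.conv K a b) =
        TreeHopf.conv K (TreeHopf.act K α a) b + TreeHopf.conv K a (TreeHopf.act K α b)) :=
  ⟨TreeHopf.act_mem K α a, TreeHopf.conv_mem K a b, TreeHopf.actConvAct_comul a.1 b.1 α,
    TreeHopf.act_conv_of_isInfinitesimalCharacter a.1 b.1 α.1⟩
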